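/- Let $M$ be a manifold-with-boundary (Hausdorff, second countable, of dimension $n\ge 1$), equipped with a free smooth action of $S^1$ on an open neighbourhood $U_M$ of $\partial M$. Let $M_{\mathrm{cut}}=M/{\sim}$, where distinct points are equivalent iff they both lie in $\partial M$ and in the same $S^1$-orbit, with the quotient topology and quotient map $c\colon M\to M_{\mathrm{cut}}$. Let $M_{\mathrm{red}}=(\partial M)/S^1=c(\partial M)\subset M_{\mathrm{cut}}$. Fix an invariant boundary defining function, i.e. a smooth $f\colon M\to\mathbb R_{\ge 0}$ with $f^{-1}(0)=\partial M$, with $df\ne 0$ at every point of $\partial M$, and $S^1$-invariant on some invariant open neighbourhood of $\partial M$ in $U_M$. Equip $M_{\mathrm{cut}}$ with its manifold structure whose smooth functions are exactly those $h\colon M_{\mathrm{cut}}\to\mathbb R$ such that $h\circ c$ is smooth on the interior $\mathring M$ and there are an $S^1$-invariant open neighbourhood $V\subset U_M$ of $\partial M$ and a smooth $H\colon V\times\mathbb C\to\mathbb R$ with $H(a\cdot x,z)=H(x,az)$ for all $a\in S^1$, $(x,z)\in V\times\mathbb C$, and $h(c(x))=H(x,\sqrt{f(x)})$ for all $x\in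 V$. Equip $M_{\mathrm{red}}$ with the manifold structure that makes the quotient map $\partial M\to M_{\mathrm{red}}$ a principal $S^1$-bundle. Let $\beta$ be a smooth differential $k$-form on $M$ whose pullback to $\partial M$ is $S^1$-basic (horizontal and invariant) and which is $S^1$-invariant on some invariant open neighbourhood of $\partial M$ in $U_M$. Let $\beta_{\mathrm{cut}}$ be the induced differential form on $M_{\mathrm{cut}}$, i.e. the one whose pullback by $c|_{\mathring M}$ is $\beta|_{\mathring M}$, and let $\beta_{\mathrm{red}}$ be the induced differential form on $M_{\mathrm{red}}$, i.e. the one whose pullback to $\partial M$ equals the pullback of $\beta$ to $\partial M$. Then the inclusion $M_{\mathrm{red}}\to M_{\mathrm{cut}}$ is smooth, and $\beta_{\mathrm{red}}$ equals the pullback of $\beta_{\mathrm{cut}}$ under it. -/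

import Mathlib

open Set Function
open scoped Manifold ContDiff Topology

noncomputable section

/-! ## Differential forms on manifolds (possibly with boundary) -/

section Forms

variable {E : Type*} [NormedAddCommGroup E] [NormedSpace ℝ E]
  {H : Type*} [TopologicalSpace H] (I : ModelWithCorners ℝ E H)
  {E' : Type*} [NormedAddCommGroup E'] [NormedSpace ℝ E']
  {H' : Type*} [TopologicalSpace H'] (I' : ModelWithCorners ℝ E' H')
  (N : Type*) [TopologicalSpace N] [ChartedSpace H N]
  {N' : Type*} [TopologicalSpace N'] [ChartedSpace H' N']

/-- A (not necessarily smooth) field of alternating `k`-forms on the tangent spaces of `N`. -/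
abbrev FormField (k : ℕ) : Type _ := ∀ x : N, (TangentSpace I x) [⋀^Fin k]→L[ℝ] ℝ

variable {N}

/-- The expression of a field of forms in the preferred chart at `x₀`: its pullback under the
inverse of that chart, as a function on the model vector space. -/
def FormField.inChart {k : ℕ} (α : FormField I N k) (x₀ : N) (y : E) : E [⋀^Fin k]→L[ℝ] ℝ :=
  (α ((extChartAt I x₀).symm y)).compContinuousLinearMap
    (mfderivWithin 𝓘(ℝ, E) I (extChartAt I x₀).symm (range I) y)

/-- The pullback of a field of forms under a map `g : N → N'`. -/
def FormField.pullback {k : ℕ} (g : N → N') (α : FormField I' N' k) : FormField I N k :=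
  fun x ↦ (α (g x)).compContinuousLinearMap (mfderiv I I' g x)

variable (N)

/-- A smooth differential form of degree `k` on `N`. -/
structure DiffForm (k : ℕ) where
  /-- The value of the form at each point. -/
  toField : FormField I N k
  /-- In charts, the coefficients of the form are smooth functions. -/
  smooth : ∀ x₀ : N, ContDiffOn ℝ ∞ (FormField.inChart I toField x₀) (extChartAt I x₀).target

end Forms

/-! ## The boundary of a manifold-with-boundary, as a manifold -/

section Boundary

variable (d : ℕ)

/-- The inclusion of `ℝ^d` as the boundary `{x | x 0 = 0}` of the half-space in `ℝ^(d+1)`. -/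
def halfSpaceCons (y : EuclideanSpace ℝ (Fin d)) : EuclideanHalfSpace (d + 1) :=
  ⟨WithLp.toLp 2 (Fin.cons 0 (fun i ↦ y i)), by simp⟩

/-- Dropping the coordinate with index zero. -/
def halfSpaceTail (z : EuclideanHalfSpace (d + 1)) : EuclideanSpace ℝ (Fin d) :=
  WithLp.toLp 2 (fun i : Fin d ↦ z.1 i.succ)

theorem continuous_halfSpaceCons : Continuous (halfSpaceCons d) := by
  refine Continuous.subtype_mk ?_ _
  refine (PiLp.continuous_toLp 2 _).comp (continuous_pi fun i ↦ ?_)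
  refine Fin.cases ?_ (fun j ↦ ?_) i
  · simpa using continuous_const
  · simpa using PiLp.continuous_apply 2 _ j

theorem continuous_halfSpaceTail : Continuous (halfSpaceTail d) :=
  (PiLp.continuous_toLp 2 _).comp
    (continuous_pi fun i ↦ (PiLp.continuous_apply 2 _ i.succ).comp continuous_subtype_val)

theorem halfSpaceTail_cons (y : EuclideanSpace ℝ (Fin d)) :
    halfSpaceTail d (halfSpaceCons d y) = y := by
  ext i; simp [halfSpaceTail, halfSpaceCons]

theorem halfSpaceCons_tail {z : EuclideanHalfSpace (d + 1)} (hz : z.1 0 = 0) :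
    halfSpaceCons d (halfSpaceTail d z) = z := by
  apply EuclideanHalfSpace.ext
  ext i
  refine Fin.cases ?_ (fun j ↦ ?_) i
  · simp [halfSpaceCons, hz]
  · simp [halfSpaceTail, halfSpaceCons]

variable (M : Type*) [TopologicalSpace M] [ChartedSpace (EuclideanHalfSpace (d + 1)) M]

/-- The boundary `∂M` of a `(d+1)`-dimensional manifold-with-boundary. -/
abbrev Bdry : Type _ := ↥((𝓡∂ (d + 1)).boundary M)

variable {M} [IsManifold (𝓡∂ (d + 1)) ∞ M]

theorem mem_boundary_iff_chart {e : OpenPartialHomeomorph M (EuclideanHalfSpace (d + 1))}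
    (he : e ∈ atlas (EuclideanHalfSpace (d + 1)) M) {x : M} (hx : x ∈ e.source) :
    x ∈ (𝓡∂ (d + 1)).boundary M ↔ (e x).1 0 = 0 := by
  rw [← not_iff_not]
  have h1 : x ∉ (𝓡∂ (d + 1)).boundary M ↔ (𝓡∂ (d + 1)).IsInteriorPoint x :=
    ((𝓡∂ (d + 1)).isInteriorPoint_iff_not_isBoundaryPoint x).symm
  rw [h1, (𝓡∂ (d + 1)).isInteriorPoint_iff_of_mem_atlas (n := ∞) (by simp) he hx]
  have h2 : e.extend (𝓡∂ (d + 1)) x ∈ interior (e.extend (𝓡∂ (d + 1))).target ↔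
      (𝓡∂ (d + 1)) (e x) ∈ interior (range (𝓡∂ (d + 1))) :=
    ⟨fun h ↦ OpenPartialHomeomorph.interior_extend_target_subset_interior_range _ h,
      fun h ↦ e.mem_interior_extend_target (e.map_source hx) h⟩
  rw [h2, interior_range_modelWithCornersEuclideanHalfSpace]
  have h0 : 0 ≤ (e x).1 0 := (e x).2
  change 0 < (e x).1 0 ↔ _
  exact ⟨fun h ↦ h.ne', fun h ↦ lt_of_le_of_ne h0 (Ne.symm h)⟩

open Classical in
/-- The chart on `∂M` obtained by restricting the preferred chart of `M` at a boundary point `p`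
and dropping the coordinate that vanishes. -/
def bdryChart (p : Bdry d M) : OpenPartialHomeomorph (Bdry d M) (EuclideanSpace ℝ (Fin d)) where
  toFun x := halfSpaceTail d (chartAt (EuclideanHalfSpace (d + 1)) p.1 x.1)
  invFun y :=
    if h : (chartAt (EuclideanHalfSpace (d + 1)) p.1).symm (halfSpaceCons d y)
        ∈ (𝓡∂ (d + 1)).boundary M then ⟨_, h⟩ else p
  source := {x | x.1 ∈ (chartAt (EuclideanHalfSpace (d + 1)) p.1).source}
  target := {y | halfSpaceCons d y ∈ (chartAt (EuclideanHalfSpace (d + 1)) p.1).target}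
  map_source' x hx := by
    have h := (mem_boundary_iff_chart d (chart_mem_atlas _ p.1) hx).1 x.2
    rw [mem_ofPred_eq, halfSpaceCons_tail d h]
    exact OpenPartialHomeomorph.map_source _ hx
  map_target' y hy := by
    have hs := OpenPartialHomeomorph.map_target _ hy
    have h := (mem_boundary_iff_chart d (chart_mem_atlas _ p.1) hs).2
      (by rw [OpenPartialHomeomorph.right_inv _ hy]; simp [halfSpaceCons])
    rw [dif_pos h]
    exact hs
  left_inv' x hx := by
    have h := (mem_boundary_iff_chart d (chart_mem_atlas _ p.1) hx).1 x.2
    have e1 : (chartAt (EuclideanHalfSpace (d + 1)) p.1).symm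
        (halfSpaceCons d (halfSpaceTail d (chartAt (EuclideanHalfSpace (d + 1)) p.1 x.1)))
        = x.1 := by
      rw [halfSpaceCons_tail d h, OpenPartialHomeomorph.left_inv _ hx]
    have h2 := e1 ▸ x.2
    apply Subtype.ext
    rw [dif_pos h2]
    exact e1
  right_inv' y hy := by
    have hs := OpenPartialHomeomorph.map_target _ hy
    have h := (mem_boundary_iff_chart d (chart_mem_atlas _ p.1) hs).2
      (by rw [OpenPartialHomeomorph.right_inv _ hy]; simp [halfSpaceCons])
    rw [dif_pos h]
    change halfSpaceTail d (chartAt (EuclideanHalfSpace (d + 1)) p.1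
      ((chartAt (EuclideanHalfSpace (d + 1)) p.1).symm (halfSpaceCons d y))) = y
    rw [OpenPartialHomeomorph.right_inv _ hy, halfSpaceTail_cons]
  open_source :=
    (chartAt (EuclideanHalfSpace (d + 1)) p.1).open_source.preimage continuous_subtype_val
  open_target :=
    (chartAt (EuclideanHalfSpace (d + 1)) p.1).open_target.preimage (continuous_halfSpaceCons d)
  continuousOn_toFun := (continuous_halfSpaceTail d).comp_continuousOn
    ((chartAt (EuclideanHalfSpace (d + 1)) p.1).continuousOn.comp
      continuous_subtype_val.continuousOn fun _ hx ↦ hx)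
  continuousOn_invFun := by
    rw [Topology.IsInducing.subtypeVal.continuousOn_iff]
    refine ContinuousOn.congr ((chartAt (EuclideanHalfSpace (d + 1)) p.1).continuousOn_symm.comp
      (continuous_halfSpaceCons d).continuousOn fun _ hy ↦ hy) fun y hy ↦ ?_
    have hs := OpenPartialHomeomorph.map_target _ hy
    have h := (mem_boundary_iff_chart d (chart_mem_atlas _ p.1) hs).2
      (by rw [OpenPartialHomeomorph.right_inv _ hy]; simp [halfSpaceCons])
    simp only [comp_apply]
    rw [dif_pos h]

instance : ChartedSpace (EuclideanSpace ℝ (Fin d)) (Bdry d M) where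
  atlas := range (bdryChart d)
  chartAt p := bdryChart d p
  mem_chart_source p := mem_chart_source (EuclideanHalfSpace (d + 1)) p.1
  chart_mem_atlas p := mem_range_self p

theorem bdryChart_symm_val (p : Bdry d M) {y : EuclideanSpace ℝ (Fin d)}
    (hy : y ∈ (bdryChart d p).target) :
    ((bdryChart d p).symm y).1
      = (chartAt (EuclideanHalfSpace (d + 1)) p.1).symm (halfSpaceCons d y) := by
  have hy' : halfSpaceCons d y ∈ (chartAt (EuclideanHalfSpace (d + 1)) p.1).target := hy
  have hs := OpenPartialHomeomorph.map_target _ hy'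
  have h := (mem_boundary_iff_chart d (chart_mem_atlas _ p.1) hs).2
    (by rw [OpenPartialHomeomorph.right_inv _ hy']; simp [halfSpaceCons])
  exact congrArg Subtype.val (dif_pos h)

instance : IsManifold (𝓡 d) ∞ (Bdry d M) := by
  refine isManifold_of_contDiffOn _ _ _ ?_
  rintro _ _ ⟨p, rfl⟩ ⟨q, rfl⟩
  let e := chartAt (EuclideanHalfSpace (d + 1)) p.1
  let e' := chartAt (EuclideanHalfSpace (d + 1)) q.1
  have hc : ContDiffOn ℝ ∞ ((𝓡∂ (d + 1)) ∘ (e.symm ≫ₕ e') ∘ (𝓡∂ (d + 1)).symm)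
      ((𝓡∂ (d + 1)).symm ⁻¹' (e.symm ≫ₕ e').source ∩ range (𝓡∂ (d + 1))) :=
    ((contDiffGroupoid ∞ (𝓡∂ (d + 1))).compatible (chart_mem_atlas _ p.1)
      (chart_mem_atlas _ q.1)).1
  have hcons : ContDiff ℝ ∞ (fun y : EuclideanSpace ℝ (Fin d) ↦ (halfSpaceCons d y).1) := by
    rw [contDiff_piLp]
    intro i
    refine Fin.cases ?_ (fun j ↦ ?_) i
    · simpa [halfSpaceCons] using contDiff_const
    · simpa [halfSpaceCons] using contDiff_piLp_apply (p := 2)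
  have htail : ContDiff ℝ ∞ (fun z : EuclideanSpace ℝ (Fin (d + 1)) ↦
      (WithLp.toLp 2 (fun i : Fin d ↦ z i.succ) : EuclideanSpace ℝ (Fin d))) := by
    rw [contDiff_piLp]
    intro i
    exact contDiff_piLp_apply (p := 2)
  have hI (y : EuclideanSpace ℝ (Fin d)) :
      (𝓡∂ (d + 1)).symm (halfSpaceCons d y).1 = halfSpaceCons d y :=
    (𝓡∂ (d + 1)).left_inv (halfSpaceCons d y)
  have key : ∀ y ∈ ((bdryChart d p).symm ≫ₕ bdryChart d q).source,
      halfSpaceCons d y ∈ (e.symm ≫ₕ e').source ∧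
      ((bdryChart d p).symm ≫ₕ bdryChart d q) y
        = halfSpaceTail d ((e.symm ≫ₕ e') (halfSpaceCons d y)) := by
    intro y hy
    rw [OpenPartialHomeomorph.trans_source] at hy
    have hv := bdryChart_symm_val d p hy.1
    have h2 : ((bdryChart d p).symm y).1 ∈ e'.source := hy.2
    rw [hv] at h2
    refine ⟨?_, ?_⟩
    · rw [OpenPartialHomeomorph.trans_source]
      exact ⟨hy.1, h2⟩
    · change halfSpaceTail d (e' ((bdryChart d p).symm y).1) = _
      rw [hv]; rfl
  have hcomp := htail.comp_contDiffOn (hc.comp hcons.contDiffOn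
    (s := ((bdryChart d p).symm ≫ₕ bdryChart d q).source) (fun y hy ↦
      ⟨by rw [mem_preimage, hI]; exact (key y hy).1, ⟨halfSpaceCons d y, rfl⟩⟩))
  refine (hcomp.congr fun y hy ↦ ?_).mono fun y hy ↦ hy.1
  change ((bdryChart d p).symm ≫ₕ bdryChart d q) y = _
  rw [(key y hy).2]
  simp only [comp_apply, hI]
  rfl

end Boundary

/-! ## Circle actions near the boundary, and the cut space -/

/-- A free smooth circle action on an open neighbourhood of the boundary of `M`. -/
structure BoundaryCircleAction (d : ℕ) (M : Type*) [TopologicalSpace M]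
    [ChartedSpace (EuclideanHalfSpace (d + 1)) M] where
  /-- The neighbourhood of the boundary on which the circle acts. -/
  nhd : TopologicalSpace.Opens M
  /-- It contains the boundary. -/
  boundary_subset : (𝓡∂ (d + 1)).boundary M ⊆ nhd
  /-- The circle action. -/
  action : MulAction Circle nhd
  /-- The action is smooth. -/
  smooth : ContMDiff ((𝓡 1).prod (𝓡∂ (d + 1))) (𝓡∂ (d + 1)) ∞
    (fun p : Circle × nhd ↦ p.1 • p.2)
  /-- The action is free. -/
  free : ∀ (a : Circle) (x : nhd), a • x = x → a = 1

namespace BoundaryCircleAction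

attribute [instance] BoundaryCircleAction.action

variable {d : ℕ} {M : Type*} [TopologicalSpace M] [ChartedSpace (EuclideanHalfSpace (d + 1)) M]
  (A : BoundaryCircleAction d M)

theorem contMDiff_smul (a : Circle) :
    ContMDiff (𝓡∂ (d + 1)) (𝓡∂ (d + 1)) ∞ (fun x : A.nhd ↦ a • x) :=
  A.smooth.comp (contMDiff_const.prodMk contMDiff_id)

/-- An element of the circle, as a diffeomorphism of the neighbourhood of the boundary. -/
def smulDiffeo (a : Circle) : A.nhd ≃ₘ^∞⟮𝓡∂ (d + 1), 𝓡∂ (d + 1)⟯ A.nhd where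
  toEquiv := MulAction.toPerm a
  contMDiff_toFun := A.contMDiff_smul a
  contMDiff_invFun := A.contMDiff_smul a⁻¹

theorem smul_mem_boundary (a : Circle) (x : A.nhd) (hx : x.1 ∈ (𝓡∂ (d + 1)).boundary M) :
    (a • x).1 ∈ (𝓡∂ (d + 1)).boundary M := by
  have h := (A.smulDiffeo a).preimage_boundary (I := 𝓡∂ (d + 1)) (I' := 𝓡∂ (d + 1)) (by simp)
  have hx' : x ∈ (𝓡∂ (d + 1)).boundary A.nhd := by
    rw [ModelWithCorners.boundary_open]; exact hx
  rw [← h] at hx'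
  have h3 : a • x ∈ (𝓡∂ (d + 1)).boundary A.nhd := hx'
  rw [ModelWithCorners.boundary_open] at h3
  exact h3

/-- A boundary point, as a point of the neighbourhood on which the circle acts. -/
def bdryPt (p : Bdry d M) : A.nhd := ⟨p.1, A.boundary_subset p.2⟩

/-- The circle action on `∂M`. -/
def bdrySMul (a : Circle) (p : Bdry d M) : Bdry d M :=
  ⟨(a • A.bdryPt p).1, A.smul_mem_boundary a (A.bdryPt p) p.2⟩

theorem bdryPt_bdrySMul (a : Circle) (p : Bdry d M) :
    A.bdryPt (A.bdrySMul a p) = a • A.bdryPt p := rfl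

theorem bdrySMul_one (p : Bdry d M) : A.bdrySMul 1 p = p :=
  Subtype.ext (by simp [bdrySMul, bdryPt])

theorem bdrySMul_mul (a b : Circle) (p : Bdry d M) :
    A.bdrySMul (a * b) p = A.bdrySMul a (A.bdrySMul b p) :=
  Subtype.ext (by
    change ((a * b) • A.bdryPt p).1 = (a • A.bdryPt (A.bdrySMul b p)).1
    rw [bdryPt_bdrySMul, mul_smul])

variable [IsManifold (𝓡∂ (d + 1)) ∞ M]

/-- A set `V ⊆ M` is an invariant open neighbourhood of `∂M` in the domain of the action. -/
def IsInvariantNhd (V : Set M) : Prop :=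
  IsOpen V ∧ V ⊆ A.nhd ∧ (𝓡∂ (d + 1)).boundary M ⊆ V ∧
    ∀ (a : Circle) (x : A.nhd), x.1 ∈ V → (a • x).1 ∈ V

/-- Invariant boundary defining functions. -/
structure IsInvariantBDF (f : M → ℝ) : Prop where
  smooth : ContMDiff (𝓡∂ (d + 1)) 𝓘(ℝ, ℝ) ∞ f
  nonneg : ∀ x, 0 ≤ f x
  zero_iff : ∀ x, f x = 0 ↔ x ∈ (𝓡∂ (d + 1)).boundary M
  deriv_ne_zero : ∀ x ∈ (𝓡∂ (d + 1)).boundary M, mfderiv (𝓡∂ (d + 1)) 𝓘(ℝ, ℝ) f x ≠ 0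
  invariant : ∃ V, A.IsInvariantNhd V ∧
    ∀ (a : Circle) (x : A.nhd), x.1 ∈ V → f (a • x).1 = f x.1

/-- The orbit relation on `∂M`. -/
def orbitSetoid : Setoid (Bdry d M) where
  r p q := ∃ a : Circle, A.bdrySMul a p = q
  iseqv :=
    { refl := fun p ↦ ⟨1, A.bdrySMul_one p⟩
      symm := by
        rintro p q ⟨a, rfl⟩
        exact ⟨a⁻¹, by rw [← bdrySMul_mul, inv_mul_cancel, bdrySMul_one]⟩
      trans := by
        rintro p q r ⟨a, rfl⟩ ⟨b, rfl⟩
        exact ⟨b * a, by rw [bdrySMul_mul]⟩ }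

/-- Distinct points of `M` are equivalent iff they are both in `∂M` and in the same orbit. -/
def cutSetoid : Setoid M where
  r x y := x = y ∨ ∃ p q : Bdry d M, p.1 = x ∧ q.1 = y ∧ A.orbitSetoid p q
  iseqv :=
    { refl := fun _ ↦ Or.inl rfl
      symm := by
        rintro x y (rfl | ⟨p, q, rfl, rfl, h⟩)
        · exact Or.inl rfl
        · exact Or.inr ⟨q, p, rfl, rfl, A.orbitSetoid.symm h⟩
      trans := by
        rintro x y z (rfl | ⟨p, q, rfl, rfl, h⟩) (rfl | ⟨p', q', hp, rfl, h'⟩)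
        · exact Or.inl rfl
        · exact Or.inr ⟨p', q', hp, rfl, h'⟩
        · exact Or.inr ⟨p, q, rfl, rfl, h⟩
        · obtain rfl := Subtype.ext hp
          exact Or.inr ⟨p, q', rfl, rfl, A.orbitSetoid.trans h h'⟩ }

/-- The cut space `M_cut = M/∼`. -/
def CutSpace : Type _ := Quotient A.cutSetoid

/-- The reduced space `M_red = ∂M/S¹`. -/
def RedSpace : Type _ := Quotient A.orbitSetoid

/-- `M_cut` carries the quotient topology. -/
instance : TopologicalSpace A.CutSpace := inferInstanceAs (TopologicalSpace (Quotient _))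

/-- `M_red` carries the quotient topology. -/
instance : TopologicalSpace A.RedSpace := inferInstanceAs (TopologicalSpace (Quotient _))

/-- The quotient map `c : M → M_cut`. -/
def cutMap (x : M) : A.CutSpace := Quotient.mk A.cutSetoid x

/-- The quotient map `∂M → M_red`. -/
def redMap (p : Bdry d M) : A.RedSpace := Quotient.mk A.orbitSetoid p

/-- The inclusion `M_red → M_cut`, induced by the inclusion of `∂M` in `M`. -/
def redInclusion : A.RedSpace → A.CutSpace :=
  Quotient.map' (s₁ := A.orbitSetoid) (s₂ := A.cutSetoid) Subtype.val
    fun p q h ↦ Or.inr ⟨p, q, rfl, rfl, h⟩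

/-- The set `ℱ_M` of those real valued functions on `M_cut` that are declared to be smooth;
`f` is an invariant boundary defining function. -/
def smoothFunctions (f : M → ℝ) : Set (A.CutSpace → ℝ) :=
  {h | ContMDiffOn (𝓡∂ (d + 1)) 𝓘(ℝ, ℝ) ∞ (h ∘ A.cutMap) ((𝓡∂ (d + 1)).interior M) ∧
    ∃ V, A.IsInvariantNhd V ∧ ∃ F : M × ℂ → ℝ,
      ContMDiffOn ((𝓡∂ (d + 1)).prod 𝓘(ℝ, ℂ)) 𝓘(ℝ, ℝ) ∞ F (V ×ˢ univ) ∧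
      (∀ (a : Circle) (x : A.nhd), x.1 ∈ V → ∀ z : ℂ, F ((a • x).1, z) = F (x.1, a * z)) ∧
      ∀ x ∈ V, h (A.cutMap x) = F (x, (√(f x) : ℝ))}

/-- The given manifold structure on `M_cut` is the one whose smooth real valued functions are
exactly the functions in `ℱ_M`. -/
def IsCutStructure (f : M → ℝ) [ChartedSpace (EuclideanSpace ℝ (Fin (d + 1))) A.CutSpace] :
    Prop :=
  ∀ h : A.CutSpace → ℝ, ContMDiff (𝓡 (d + 1)) 𝓘(ℝ, ℝ) ∞ h ↔ h ∈ A.smoothFunctions f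

/-- The given manifold structure on `M_red` is the one that makes the quotient map `∂M → M_red`
a principal circle bundle: this map is smooth and is locally, on the source over an open set `W`,
equivariantly diffeomorphic to `W × S¹`, via `Φ` with inverse `x ↦ (redMap x, τ x)`. -/
def IsRedStructure [ChartedSpace (EuclideanSpace ℝ (Fin (d - 1))) A.RedSpace] : Prop :=
  ContMDiff (𝓡 d) (𝓡 (d - 1)) ∞ A.redMap ∧
  ∀ y : A.RedSpace, ∃ W : Set A.RedSpace, IsOpen W ∧ y ∈ W ∧
    ∃ (Φ : A.RedSpace × Circle → Bdry d M) (τ : Bdry d M → Circle),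
      ContMDiffOn ((𝓡 (d - 1)).prod (𝓡 1)) (𝓡 d) ∞ Φ (W ×ˢ univ) ∧
      ContMDiffOn (𝓡 d) (𝓡 1) ∞ τ (A.redMap ⁻¹' W) ∧
      (∀ w ∈ W, ∀ a, A.redMap (Φ (w, a)) = w ∧ τ (Φ (w, a)) = a) ∧
      (∀ x ∈ A.redMap ⁻¹' W, Φ (A.redMap x, τ x) = x) ∧
      (∀ w ∈ W, ∀ a b, Φ (w, a * b) = A.bdrySMul a (Φ (w, b)))

/-! ## Differential forms and the circle action -/

/-- The vector field on `∂M` that generates the circle action. -/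
def generator (p : Bdry d M) : TangentSpace (𝓡 d) p :=
  mfderiv 𝓘(ℝ, ℝ) (𝓡 d) (fun t : ℝ ↦ A.bdrySMul (Circle.exp t) p) 0 (1 : ℝ)

/-- A field of forms on `∂M` is basic if it is horizontal (its contraction with the generating
vector field vanishes) and invariant. -/
def IsBasicField {k : ℕ} (γ : FormField (𝓡 d) (Bdry d M) k) : Prop :=
  (∀ (p : Bdry d M) (v : Fin k → TangentSpace (𝓡 d) p), (∃ i, v i = A.generator p) → γ p v = 0) ∧
  ∀ a : Circle, FormField.pullback (𝓡 d) (𝓡 d) (A.bdrySMul a) γ = γ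

variable {A} in
/-- The pullback of a form on `M` to `∂M`. -/
def toBdry {k : ℕ} (β : DiffForm (𝓡∂ (d + 1)) M k) : FormField (𝓡 d) (Bdry d M) k :=
  FormField.pullback (𝓡 d) (𝓡∂ (d + 1)) Subtype.val β.toField

/-- `β` is basic on `∂M`. -/
def IsBasicOnBdry {k : ℕ} (β : DiffForm (𝓡∂ (d + 1)) M k) : Prop :=
  A.IsBasicField (toBdry β)

/-- `β` is invariant near `∂M`. -/
def IsInvariantNearBdry {k : ℕ} (β : DiffForm (𝓡∂ (d + 1)) M k) : Prop :=
  ∃ V, A.IsInvariantNhd V ∧ ∀ (a : Circle) (x : A.nhd), x.1 ∈ V →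
    FormField.pullback (𝓡∂ (d + 1)) (𝓡∂ (d + 1)) (fun x : A.nhd ↦ a • x)
      (FormField.pullback (𝓡∂ (d + 1)) (𝓡∂ (d + 1)) (Subtype.val : A.nhd → M) β.toField) x =
    FormField.pullback (𝓡∂ (d + 1)) (𝓡∂ (d + 1)) (Subtype.val : A.nhd → M) β.toField x

/-- `βcut` is the form on `M_cut` induced by `β`: its pullback through the restriction of
`c : M → M_cut` to the interior of `M` is `β`. -/
def IsCutForm {k : ℕ} [ChartedSpace (EuclideanSpace ℝ (Fin (d + 1))) A.CutSpace]
    (β : DiffForm (𝓡∂ (d + 1)) M k) (βcut : DiffForm (𝓡 (d + 1)) A.CutSpace k) : Prop :=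
  ∀ x ∈ (𝓡∂ (d + 1)).interior M,
    FormField.pullback (𝓡∂ (d + 1)) (𝓡 (d + 1)) A.cutMap βcut.toField x = β.toField x

/-- `βred` is the form on `M_red` induced by `β`: its pullback to `∂M` is the pullback of `β`
to `∂M`. -/
def IsRedForm {k : ℕ} [ChartedSpace (EuclideanSpace ℝ (Fin (d - 1))) A.RedSpace]
    (β : DiffForm (𝓡∂ (d + 1)) M k) (βred : DiffForm (𝓡 (d - 1)) A.RedSpace k) : Prop :=
  FormField.pullback (𝓡 d) (𝓡 (d - 1)) A.redMap βred.toField = toBdry β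

end BoundaryCircleAction

end

open Set Function
open scoped Manifold ContDiff Topology

/-! Write `c` for the quotient map, `i : ∂M → M` for the inclusion and `π : ∂M → M_red` for the
bundle projection, so that the inclusion `j : M_red → M_cut` satisfies `j ∘ π = c ∘ i`. Both claims
descend along `π`. It has smooth local sections `σ`, so locally `j = c ∘ i ∘ σ`, and some point over
each `y` has surjective `dπ`, so forms at `y` are determined by their pullback there. It remains to
see that `c ∘ i` is smooth and that `(c ∘ i)^* β_cut = i^* β`.

Smoothness is tested on global smooth functions `h` on `M_cut`: on `∂M` one has `f = 0`, so `h ∘ c`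
is `F(·, 0)`. Bump functions supply enough `h`, once `M_cut` is known to be Hausdorff.

The identity of forms holds on the interior by definition of `β_cut`, but it cannot just be
restricted to `∂M`, because `√f` is not smooth there and neither, in general, is `c`. Instead,
approach `p ∈ ∂M` along the inward ray of a chart and feed both forms vectors `v` tangent to the
boundary. The chain rule for `F(x, √f(x))` gives the singular term `df(v) / (2√f)`. At distance `t`
along the ray, `df(v) = O(t)` since it vanishes at `p`, while `f` is comparable to `t`, so this term
is `O(√t)`. Hence `dc(v)` converges to `d(c ∘ i)(v)` (`tendsto_fderiv_comp_sqrt`,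
`tendsto_fderivWithin_cutMap`), and continuity of `β` and `β_cut` yields `pullback_cutMap_val`. -/

noncomputable section

/-! ### Detecting smoothness of maps by global smooth functions -/

section SmoothByFunctions

variable {E : Type*} [NormedAddCommGroup E] [NormedSpace ℝ E]
  {H : Type*} [TopologicalSpace H] {I : ModelWithCorners ℝ E H}
  {X : Type*} [TopologicalSpace X] [ChartedSpace H X]
  {m : ℕ} {N : Type*} [TopologicalSpace N] [T2Space N]
  [ChartedSpace (EuclideanSpace ℝ (Fin m)) N] [IsManifold (𝓡 m) ∞ N]

/-- Each chart coordinate agrees near the base point with a global smooth function. -/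
theorem exists_contMDiff_eventuallyEq_coord (q : N) (i : Fin m) :
    ∃ h : N → ℝ, ContMDiff (𝓡 m) 𝓘(ℝ, ℝ) ∞ h ∧
      ∀ᶠ z in 𝓝 q, h z = extChartAt (𝓡 m) q z i := by
  obtain ⟨b⟩ : Nonempty (SmoothBumpFunction (𝓡 m) q) := inferInstance
  refine ⟨fun z ↦ b z • extChartAt (𝓡 m) q z i, b.contMDiff_smul ?_, ?_⟩
  · have h1 : ContMDiffOn (𝓡 m) 𝓘(ℝ, EuclideanSpace ℝ (Fin m)) ∞ (extChartAt (𝓡 m) q)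
        (chartAt (EuclideanSpace ℝ (Fin m)) q).source := contMDiffOn_extChartAt
    have h2 : ContMDiff 𝓘(ℝ, EuclideanSpace ℝ (Fin m)) 𝓘(ℝ, ℝ) ∞
        (fun z : EuclideanSpace ℝ (Fin m) ↦ z i) :=
      (contDiff_piLp_apply (p := 2)).contMDiff
    exact h2.comp_contMDiffOn h1
  · filter_upwards [b.eventuallyEq_one] with z hz
    simp [hz]

/-- A continuous map is smooth at a point if its compositions with all global smooth functions
are. -/
theorem contMDiffAt_of_forall_comp {g : X → N} {x : X} (hg : ContinuousAt g x)
    (h : ∀ h : N → ℝ, ContMDiff (𝓡 m) 𝓘(ℝ, ℝ) ∞ h → ContMDiffAt I 𝓘(ℝ, ℝ) ∞ (h ∘ g) x) :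
    ContMDiffAt I (𝓡 m) ∞ g x := by
  rw [contMDiffAt_iff_target]
  refine ⟨hg, ?_⟩
  choose φ hφ hφ' using exists_contMDiff_eventuallyEq_coord (m := m) (g x)
  have h1 : ContMDiffAt I 𝓘(ℝ, Fin m → ℝ) ∞ (fun y i ↦ φ i (g y)) x :=
    contMDiffAt_pi_space.2 fun i ↦ h _ (hφ i)
  have h2 : ContMDiff 𝓘(ℝ, Fin m → ℝ) 𝓘(ℝ, EuclideanSpace ℝ (Fin m)) ∞
      (WithLp.toLp 2 : (Fin m → ℝ) → EuclideanSpace ℝ (Fin m)) :=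
    (PiLp.contDiff_toLp (p := 2)).contMDiff
  refine (h2.contMDiffAt.comp x h1).congr_of_eventuallyEq ?_
  filter_upwards [Filter.eventually_all.2 fun i ↦ hg.eventually (hφ' i)] with y hy
  ext i
  exact (hy i).symm

end SmoothByFunctions

/-! ### Topology of the cut space -/

namespace BoundaryCircleAction

variable {d : ℕ} {M : Type*} [TopologicalSpace M] [ChartedSpace (EuclideanHalfSpace (d + 1)) M]
  (A : BoundaryCircleAction d M)

theorem continuous_bdrySMul : Continuous fun q : Circle × Bdry d M ↦ A.bdrySMul q.1 q.2 := by
  have h : Continuous fun q : Circle × Bdry d M ↦ (q.1, A.bdryPt q.2) :=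
    continuous_fst.prodMk (Continuous.subtype_mk (continuous_subtype_val.comp continuous_snd) _)
  exact Continuous.subtype_mk (continuous_subtype_val.comp (A.smooth.continuous.comp h)) _

theorem continuous_cutMap : Continuous A.cutMap := continuous_quotient_mk'

theorem cutMap_surjective : Surjective A.cutMap := Quotient.mk_surjective

theorem redInclusion_redMap (p : Bdry d M) : A.redInclusion (A.redMap p) = A.cutMap p.1 := rfl

theorem continuous_redInclusion : Continuous A.redInclusion :=
  continuous_quot_lift _ (A.continuous_cutMap.comp continuous_subtype_val)

variable [IsManifold (𝓡∂ (d + 1)) ∞ M]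

/-- The saturation of a closed `C` is `C` together with the circle sweep of `C ∩ ∂M`. The sweep is
the projection to `∂M` of a closed subset of `Circle × ∂M`, hence closed because the circle is
compact; and `∂M` is closed in `M`. -/
theorem isClosedMap_cutMap : IsClosedMap A.cutMap := by
  intro C hC
  have hq : Topology.IsQuotientMap A.cutMap := isQuotientMap_quotient_mk'
  rw [← hq.isClosed_preimage]
  have hbd : IsClosed ((𝓡∂ (d + 1)).boundary M) :=
    ModelWithCorners.isClosed_boundary (n := ∞) (by simp)
  have h1 : IsClosed {q : Circle × Bdry d M | (A.bdrySMul q.1 q.2).1 ∈ C} :=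
    hC.preimage (continuous_subtype_val.comp A.continuous_bdrySMul)
  have h2 := hbd.isClosedEmbedding_subtypeVal.isClosedMap _ (isClosedMap_snd_of_compactSpace _ h1)
  convert hC.union h2 using 1
  ext x
  constructor
  · rintro ⟨y, hy, hxy⟩
    rcases Quotient.exact hxy.symm with rfl | ⟨p, q, rfl, rfl, a, rfl⟩
    · exact Or.inl hy
    · exact Or.inr ⟨p, ⟨(a, p), hy, rfl⟩, rfl⟩
  · rintro (hx | ⟨p, ⟨⟨a, p'⟩, hy, rfl⟩, rfl⟩)
    · exact ⟨x, hx, rfl⟩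
    · exact ⟨_, hy, (Quotient.sound (Or.inr ⟨p', _, rfl, rfl, a, rfl⟩)).symm⟩

/-- Fibres of `c` are closed and `M` is normal, so two fibres have disjoint open neighbourhoods;
since `c` is closed, these shrink to saturated ones. Hausdorffness is what allows bump functions on
`M_cut`. -/
theorem t2Space_cutSpace [T2Space M] [SecondCountableTopology M] : T2Space A.CutSpace := by
  have := Manifold.locallyCompact_of_finiteDimensional (M := M) (𝓡∂ (d + 1))
  have : NormalSpace M := inferInstance
  refine ⟨fun a b hab ↦ ?_⟩
  have hcl (a : A.CutSpace) : IsClosed (A.cutMap ⁻¹' {a}) := by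
    obtain ⟨x, rfl⟩ := A.cutMap_surjective a
    have h := A.isClosedMap_cutMap {x} isClosed_singleton
    rw [image_singleton] at h
    exact h.preimage A.continuous_cutMap
  obtain ⟨U, V, hU, hV, haU, hbV, hUV⟩ := normal_separation (hcl a) (hcl b)
    (Disjoint.preimage _ (by simpa using hab))
  refine ⟨(A.cutMap '' Uᶜ)ᶜ, (A.cutMap '' Vᶜ)ᶜ,
    (A.isClosedMap_cutMap _ hU.isClosed_compl).isOpen_compl,
    (A.isClosedMap_cutMap _ hV.isClosed_compl).isOpen_compl, ?_, ?_, ?_⟩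
  · rintro ⟨x, hx, rfl⟩
    exact hx (haU rfl)
  · rintro ⟨x, hx, rfl⟩
    exact hx (hbV rfl)
  · rw [disjoint_left]
    intro z hzU hzV
    obtain ⟨x, rfl⟩ := A.cutMap_surjective z
    have h1 : x ∈ U := by by_contra hx; exact hzU ⟨x, hx, rfl⟩
    have h2 : x ∈ V := by by_contra hx; exact hzV ⟨x, hx, rfl⟩
    exact disjoint_left.1 hUV h1 h2

theorem contMDiffAt_cutMap [T2Space M] [SecondCountableTopology M] {f : M → ℝ}
    [ChartedSpace (EuclideanSpace ℝ (Fin (d + 1))) A.CutSpace]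
    [IsManifold (𝓡 (d + 1)) ∞ A.CutSpace] (hcut : A.IsCutStructure f)
    {x : M} (hx : x ∈ (𝓡∂ (d + 1)).interior M) :
    ContMDiffAt (𝓡∂ (d + 1)) (𝓡 (d + 1)) ∞ A.cutMap x := by
  have := A.t2Space_cutSpace
  refine contMDiffAt_of_forall_comp A.continuous_cutMap.continuousAt fun h hh ↦ ?_
  have hint : IsOpen ((𝓡∂ (d + 1)).interior M) :=
    ModelWithCorners.isOpen_interior (n := ∞) (by simp)
  exact ((hcut h).1 hh).1.contMDiffAt (hint.mem_nhds hx)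

end BoundaryCircleAction

/-! ## The inclusion of the boundary -/

section BoundaryInclusion

variable {d : ℕ} {M : Type*} [TopologicalSpace M] [ChartedSpace (EuclideanHalfSpace (d + 1)) M]
  [IsManifold (𝓡∂ (d + 1)) ∞ M]

/-- The inclusion of `ℝ^d` in `ℝ^(d+1)` as the hyperplane `x 0 = 0`. -/
def consCLM (d : ℕ) : EuclideanSpace ℝ (Fin d) →L[ℝ] EuclideanSpace ℝ (Fin (d + 1)) :=
  LinearMap.toContinuousLinearMap
    { toFun := fun y ↦ WithLp.toLp 2 (Fin.cons 0 (fun i ↦ y i))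
      map_add' := fun x y ↦ by
        ext i; refine Fin.cases ?_ (fun j ↦ ?_) i <;> simp
      map_smul' := fun a y ↦ by
        ext i; refine Fin.cases ?_ (fun j ↦ ?_) i <;> simp }

theorem consCLM_apply_zero (y : EuclideanSpace ℝ (Fin d)) : consCLM d y 0 = 0 := rfl

theorem extChartAt_symm_consCLM (p : Bdry d M) {y : EuclideanSpace ℝ (Fin d)}
    (hy : y ∈ (extChartAt (𝓡 d) p).target) :
    ((extChartAt (𝓡 d) p).symm y).1 = (extChartAt (𝓡∂ (d + 1)) p.1).symm (consCLM d y) := by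
  have hy' : y ∈ (bdryChart d p).target := by
    rw [extChartAt_target] at hy; exact hy.1
  have h1 : (extChartAt (𝓡∂ (d + 1)) p.1).symm (consCLM d y) =
      (chartAt (EuclideanHalfSpace (d + 1)) p.1).symm ((𝓡∂ (d + 1)).symm (halfSpaceCons d y).1) := rfl
  rw [h1]
  erw [(𝓡∂ (d + 1)).left_inv (halfSpaceCons d y)]
  rw [← bdryChart_symm_val d p hy']
  rfl

theorem extChartAt_val (p : Bdry d M) {q : Bdry d M}
    (hq : q ∈ (extChartAt (𝓡 d) p).source) :
    extChartAt (𝓡∂ (d + 1)) p.1 q.1 = consCLM d (extChartAt (𝓡 d) p q) := by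
  have hq' : q.1 ∈ (chartAt (EuclideanHalfSpace (d + 1)) p.1).source := by
    rw [extChartAt_source] at hq; exact hq
  have h := (mem_boundary_iff_chart d (chart_mem_atlas _ p.1) hq').1 q.2
  have := congrArg Subtype.val (halfSpaceCons_tail d h)
  exact this.symm

theorem contMDiff_bdry_val :
    ContMDiff (𝓡 d) (𝓡∂ (d + 1)) ∞ (Subtype.val : Bdry d M → M) := by
  intro p
  rw [contMDiffAt_iff_target]
  refine ⟨continuous_subtype_val.continuousAt, ?_⟩
  have h1 : ContMDiffAt (𝓡 d) 𝓘(ℝ, EuclideanSpace ℝ (Fin (d + 1))) ∞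
      (consCLM d ∘ extChartAt (𝓡 d) p) p :=
    (consCLM d).contMDiff.contMDiffAt.comp p contMDiffAt_extChartAt
  refine h1.congr_of_eventuallyEq ?_
  filter_upwards [extChartAt_source_mem_nhds (I := 𝓡 d) p] with q hq
  exact extChartAt_val p hq

/-- In the preferred charts at `p` of `∂M` and of `M`, the inclusion is literally the linear map
`consCLM d`. -/
theorem mfderiv_bdry_val (p : Bdry d M) :
    mfderiv (𝓡 d) (𝓡∂ (d + 1)) (Subtype.val : Bdry d M → M) p = consCLM d := by
  refine HasMFDerivAt.mfderiv ⟨continuous_subtype_val.continuousAt, ?_⟩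
  refine (consCLM d).hasFDerivAt.hasFDerivWithinAt.congr_of_eventuallyEq ?_ ?_
  · rw [ModelWithCorners.range_eq_univ, nhdsWithin_univ]
    filter_upwards [extChartAt_target_mem_nhds (I := 𝓡 d) p] with y hy
    have h := extChartAt_val p ((extChartAt (𝓡 d) p).map_target hy)
    rw [(extChartAt (𝓡 d) p).right_inv hy] at h
    exact h
  · simp only [writtenInExtChartAt, comp_apply, extChartAt_to_inv]
    exact extChartAt_val p (mem_extChartAt_source p)

end BoundaryInclusion

/-! ### One-sided calculus of compositions with a square root -/

section Calculus

variable {E : Type*} [NormedAddCommGroup E] [NormedSpace ℝ E]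

theorem hasDerivAt_add_smul (y v : E) (t : ℝ) : HasDerivAt (fun s : ℝ ↦ y + s • v) v t := by
  simpa using ((hasDerivAt_id t).smul_const v).const_add y

theorem hasDerivWithinAt_comp_add_smul {F : Type*} [NormedAddCommGroup F] [NormedSpace ℝ F]
    {g : E → F} {T : Set E} {y e : E} (hg : DifferentiableWithinAt ℝ g T y)
    {S : Set ℝ} (hS : ∀ᶠ t : ℝ in 𝓝[S] 0, y + t • e ∈ T) :
    HasDerivWithinAt (fun t : ℝ ↦ g (y + t • e)) (fderivWithin ℝ g T y e) S 0 := by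
  obtain ⟨U, hU, hUS⟩ := mem_nhdsWithin_iff_exists_mem_nhds_inter.1 hS
  have h1 : HasFDerivWithinAt g (fderivWithin ℝ g T y) T (y + (0 : ℝ) • e) := by
    simpa using hg.hasFDerivWithinAt
  have h2 := h1.comp_hasDerivWithinAt (0 : ℝ) (s := U ∩ S)
    (hasDerivAt_add_smul y e 0).hasDerivWithinAt (fun t ht ↦ hUS ht)
  -- The ray is only known to stay in `T` for small `t`; the neighbourhood `U` of `0` is discarded
  -- by locality of the derivative.
  rw [inter_comm] at h2
  exact (hasDerivWithinAt_inter hU).1 h2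

/-- If `N` vanishes at `0` and `G` has positive derivative there, then `N / √G → 0` from the
right. -/
theorem tendsto_div_sqrt_zero {N G : ℝ → ℝ} {n a : ℝ} (hN : HasDerivWithinAt N n (Ioi 0) 0)
    (hN0 : N 0 = 0) (hG : HasDerivWithinAt G a (Ioi 0) 0) (hG0 : G 0 = 0) (ha : 0 < a) :
    Filter.Tendsto (fun t ↦ N t / √(G t)) (𝓝[>] 0) (𝓝 0) := by
  have h1 := (hasDerivWithinAt_iff_tendsto_slope' (by simp)).1 hN
  have h2 := (hasDerivWithinAt_iff_tendsto_slope' (by simp)).1 hG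
  have h3 : Filter.Tendsto (fun t : ℝ ↦ √t) (𝓝[>] 0) (𝓝 0) := by
    have := Real.continuous_sqrt.tendsto 0
    rw [Real.sqrt_zero] at this
    exact this.mono_left nhdsWithin_le_nhds
  -- `N / √G = (N / t) / √(G / t) * √t`, which tends to `n / √a * 0`.
  have h4 := (h1.div ((Real.continuous_sqrt.tendsto a).comp h2) (Real.sqrt_pos.2 ha).ne').mul h3
  rw [mul_zero] at h4
  refine h4.congr' ?_
  filter_upwards [self_mem_nhdsWithin] with t ht
  have ht0 : (0 : ℝ) < t := ht
  have hs : √t ≠ 0 := (Real.sqrt_pos.2 ht0).ne'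
  have hst : √t * √t = t := Real.mul_self_sqrt ht0.le
  simp only [slope_def_field, hN0, hG0, sub_zero, comp_apply, Pi.div_apply]
  rw [Real.sqrt_div' _ ht0.le, div_div_eq_mul_div]
  -- Positivity of `G t` is not needed: if the root vanishes, both sides are `0` by the convention
  -- for division by zero.
  rcases eq_or_ne (√(G t)) 0 with h0 | h0
  · simp [h0]
  · field_simp
    rw [sq, hst]

variable {T : Set E} {G : E → ℝ} {K : E × ℂ → ℝ} {Φ : E → ℝ} {y₀ e v : E}

/-- The composition of a smooth function with `y ↦ (y, √(G y))`, along the zero set of `G`. -/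
theorem hasDerivAt_comp_sqrt (hy₀ : y₀ ∈ T)
    (hv : ∀ᶠ s : ℝ in 𝓝 0, y₀ + s • v ∈ T ∧ G (y₀ + s • v) = 0)
    (hK : ContDiffOn ℝ ∞ K (T ×ˢ univ)) (hΦ : ∀ y ∈ T, Φ y = K (y, (√(G y) : ℝ))) :
    HasDerivAt (fun s : ℝ ↦ Φ (y₀ + s • v)) (fderivWithin ℝ K (T ×ˢ univ) (y₀, 0) (v, 0)) 0 := by
  have h1 : DifferentiableWithinAt ℝ K (T ×ˢ univ) (y₀, 0) :=
    hK.differentiableOn (by simp) _ ⟨hy₀, mem_univ _⟩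
  have h2 := hasDerivWithinAt_comp_add_smul (e := ((v, 0) : E × ℂ)) h1 (S := univ)
    (by simpa using hv.mono fun _ h ↦ h.1)
  rw [hasDerivWithinAt_univ] at h2
  refine h2.congr_of_eventuallyEq ?_
  filter_upwards [hv] with s hs
  rw [hΦ _ hs.1, hs.2]
  simp

theorem fderivWithin_apply_eq_zero_of_eventually (hGd : DifferentiableWithinAt ℝ G T y₀)
    (hv : ∀ᶠ s : ℝ in 𝓝 0, y₀ + s • v ∈ T ∧ G (y₀ + s • v) = 0) :
    fderivWithin ℝ G T y₀ v = 0 := by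
  have h1 := hasDerivWithinAt_comp_add_smul (e := v) hGd (S := univ)
    (by simpa using hv.mono fun _ h ↦ h.1)
  rw [hasDerivWithinAt_univ] at h1
  exact h1.unique ((hasDerivAt_const (0 : ℝ) (0 : ℝ)).congr_of_eventuallyEq
    (hv.mono fun _ h ↦ h.2))

/-- The derivative of the composition of a smooth function with `y ↦ (y, √(G y))`, in a direction
tangent to the zero set of `G`, extends continuously to that zero set. -/
theorem tendsto_fderiv_comp_sqrt (hT : UniqueDiffOn ℝ T) (hy₀ : y₀ ∈ T)
    (hv : ∀ᶠ s : ℝ in 𝓝 0, y₀ + s • v ∈ T ∧ G (y₀ + s • v) = 0)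
    (he : ∀ᶠ t : ℝ in 𝓝[>] 0, y₀ + t • e ∈ interior T)
    (hG : ContDiffOn ℝ ∞ G T) (hGpos : ∀ᶠ t : ℝ in 𝓝[>] 0, 0 < G (y₀ + t • e))
    (hGe : fderivWithin ℝ G T y₀ e ≠ 0)
    (hK : ContDiffOn ℝ ∞ K (T ×ˢ univ)) (hΦ : ∀ y ∈ T, Φ y = K (y, (√(G y) : ℝ))) :
    Filter.Tendsto (fun t : ℝ ↦ fderiv ℝ Φ (y₀ + t • e) v) (𝓝[>] 0)
      (𝓝 (fderivWithin ℝ K (T ×ˢ univ) (y₀, 0) (v, 0))) := by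
  have heT : ∀ᶠ t : ℝ in 𝓝[>] 0, y₀ + t • e ∈ T := he.mono fun _ h ↦ interior_subset h
  have hG0 : G y₀ = 0 := by simpa using hv.self_of_nhds.2
  have hGd := hG.differentiableOn (by simp) y₀ hy₀
  have hDv := fderivWithin_apply_eq_zero_of_eventually hGd hv
  have hGt := hasDerivWithinAt_comp_add_smul hGd heT
  -- The derivative is a limit of positive difference quotients, hence nonnegative, and it is
  -- nonzero by hypothesis.
  have hpos : 0 < fderivWithin ℝ G T y₀ e := by
    refine lt_of_le_of_ne ?_ hGe.symm
    refine ge_of_tendsto ((hasDerivWithinAt_iff_tendsto_slope' (by simp)).1 hGt) ?_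
    filter_upwards [hGpos, self_mem_nhdsWithin] with t ht ht0
    have : (0 : ℝ) < t := ht0
    simp only [slope_def_field, zero_smul, add_zero, hG0, sub_zero]
    positivity
  have hDG : ContDiffOn ℝ ∞ (fderivWithin ℝ G T) T := hG.fderivWithin hT (by simp)
  have hNt := hasDerivWithinAt_comp_add_smul
    (((hDG.differentiableOn (by simp) y₀ hy₀).clm_apply
      (differentiableWithinAt_const v))) heT
  -- The numerator is `t ↦ DG(y₀ + t e) v`, differentiable because `G` is smooth up to the boundary,
  -- and zero at `t = 0` because `v` is tangent to the zero set.
  have hratio := tendsto_div_sqrt_zero hNt (by simpa using hDv) hGt (by simpa using hG0) hpos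
  have hyt : Filter.Tendsto (fun t : ℝ ↦ y₀ + t • e) (𝓝[>] 0) (𝓝 y₀) := by
    have h := (hasDerivAt_add_smul y₀ e 0).continuousAt.tendsto
    simp only [zero_smul, add_zero] at h
    exact h.mono_left nhdsWithin_le_nhds
  have hytT : Filter.Tendsto (fun t : ℝ ↦ y₀ + t • e) (𝓝[>] 0) (𝓝[T] y₀) :=
    tendsto_nhdsWithin_iff.2 ⟨hyt, heT⟩
  have hst : Filter.Tendsto (fun t : ℝ ↦ ((√(G (y₀ + t • e)) : ℝ) : ℂ)) (𝓝[>] 0) (𝓝 0) := by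
    have h1 : Filter.Tendsto (fun t : ℝ ↦ G (y₀ + t • e)) (𝓝[>] 0) (𝓝 0) := by
      have := (hG.continuousOn y₀ hy₀).tendsto.comp hytT
      rwa [hG0] at this
    have h2 := ((Complex.continuous_ofReal.comp Real.continuous_sqrt).tendsto 0).comp h1
    simpa [comp_def] using h2
  have hTu : UniqueDiffOn ℝ (T ×ˢ (univ : Set ℂ)) := hT.prod uniqueDiffOn_univ
  have hDK : ContinuousOn (fderivWithin ℝ K (T ×ˢ univ)) (T ×ˢ univ) :=
    (hK.fderivWithin (m := ∞) hTu (by simp)).continuousOn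
  have hpt : Filter.Tendsto (fun t : ℝ ↦ (y₀ + t • e, ((√(G (y₀ + t • e)) : ℝ) : ℂ))) (𝓝[>] 0)
      (𝓝[T ×ˢ univ] (y₀, 0)) :=
    tendsto_nhdsWithin_iff.2 ⟨hyt.prodMk_nhds hst, heT.mono fun t ht ↦ ⟨ht, mem_univ _⟩⟩
  have hDKt : Filter.Tendsto (fun t : ℝ ↦ fderivWithin ℝ K (T ×ˢ univ)
      (y₀ + t • e, ((√(G (y₀ + t • e)) : ℝ) : ℂ))) (𝓝[>] 0) (𝓝 (fderivWithin ℝ K (T ×ˢ univ) (y₀, 0))) :=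
    (hDK (y₀, 0) ⟨hy₀, mem_univ _⟩).tendsto.comp hpt
  -- The vector fed to `DK` by the chain rule: its second entry is the derivative `DG(v) / (2√G)` of
  -- `√G` along `v`.
  have hvec : Filter.Tendsto (fun t : ℝ ↦ ((v, ((fderivWithin ℝ G T (y₀ + t • e) v /
      √(G (y₀ + t • e)) / 2 : ℝ) : ℂ)) : E × ℂ)) (𝓝[>] 0) (𝓝 (v, 0)) := by
    refine tendsto_const_nhds.prodMk_nhds ?_
    have h := (Complex.continuous_ofReal.tendsto (0 / 2)).comp (hratio.div_const 2)
    simpa [comp_def] using h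
  have hlim := (isBoundedBilinearMap_apply (𝕜 := ℝ) (E := E × ℂ) (F := ℝ)).continuous.tendsto
    (fderivWithin ℝ K (T ×ˢ univ) (y₀, 0), (v, 0)) |>.comp (hDKt.prodMk_nhds hvec)
  refine hlim.congr' ?_
  -- For small `t > 0` the point is interior to `T` and `G > 0`, so derivatives within `T` are full
  -- derivatives and `√G` is differentiable.
  filter_upwards [he, hGpos] with t ht hGt
  set y := y₀ + t • e
  have hTy : T ∈ 𝓝 y := mem_interior_iff_mem_nhds.1 ht
  have hGy : HasFDerivAt G (fderivWithin ℝ G T y) y :=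
    ((hG.differentiableOn (by simp) y (mem_of_mem_nhds hTy)).hasFDerivWithinAt).hasFDerivAt hTy
  have hKy : HasFDerivAt K (fderivWithin ℝ K (T ×ˢ univ) (y, ((√(G y) : ℝ) : ℂ)))
      (y, ((√(G y) : ℝ) : ℂ)) :=
    ((hK.differentiableOn (by simp) _ ⟨mem_of_mem_nhds hTy, mem_univ _⟩).hasFDerivWithinAt).hasFDerivAt
      (prod_mem_nhds hTy Filter.univ_mem)
  have hsq := Complex.ofRealCLM.hasFDerivAt.comp y (hGy.sqrt hGt.ne')
  have hcomp := hKy.comp y ((hasFDerivAt_id y).prodMk hsq)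
  have hΦy : HasFDerivAt Φ _ y := hcomp.congr_of_eventuallyEq (by
    filter_upwards [hTy] with z hz using hΦ z hz)
  rw [hΦy.fderiv]
  simp only [comp_apply, ContinuousLinearMap.comp_apply, ContinuousLinearMap.prod_apply,
    smul_apply, smul_eq_mul, ContinuousLinearMap.id_apply]
  congr 2
  rw [Complex.ofRealCLM_apply]
  congr 1
  ring

end Calculus

/-! ### Differential forms in charts -/

section FormsInCharts

variable {E : Type*} [NormedAddCommGroup E] [NormedSpace ℝ E]
  {H : Type*} [TopologicalSpace H] {I : ModelWithCorners ℝ E H}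
  {E' : Type*} [NormedAddCommGroup E'] [NormedSpace ℝ E']
  {H' : Type*} [TopologicalSpace H'] {I' : ModelWithCorners ℝ E' H'}
  {N : Type*} [TopologicalSpace N] [ChartedSpace H N] [IsManifold I ∞ N]
  {N' : Type*} [TopologicalSpace N'] [ChartedSpace H' N'] [IsManifold I' ∞ N']

theorem FormField.inChart_self {k : ℕ} (α : FormField I N k) (x : N) (v : Fin k → E) :
    FormField.inChart I α x (extChartAt I x x) v = α x v := by
  -- All tangent spaces are definitionally `E`, so the values of `α` at propositionally equal points
  -- can be compared without transport.
  have hα : ∀ z, z = x → (α z : E [⋀^Fin k]→L[ℝ] ℝ) = α x := by rintro z rfl; rfl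
  change (α ((extChartAt I x).symm (extChartAt I x x)) : E [⋀^Fin k]→L[ℝ] ℝ)
    (mfderivWithin 𝓘(ℝ, E) I (extChartAt I x).symm (range I) (extChartAt I x x) ∘ v) = _
  rw [hα _ (extChartAt_to_inv x)]
  congr 1
  funext i
  have := IsManifold.of_le (I := I) (M := N) (m := 1) (n := ∞) (by simp)
  exact congrArg (fun L : E →L[ℝ] E ↦ L (v i)) (mfderivWithin_range_extChartAt_symm (I := I) (x := x))

theorem FormField.inChart_apply_mfderiv {k : ℕ} (α : FormField I N k) (x : N) {z : N}
    (hz : z ∈ (extChartAt I x).source) (v : Fin k → TangentSpace I z) :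
    FormField.inChart I α x (extChartAt I x z)
      (fun i ↦ mfderiv I 𝓘(ℝ, E) (extChartAt I x) z (v i)) = α z v := by
  have hα : ∀ z', z' = z → (α z' : E [⋀^Fin k]→L[ℝ] ℝ) = α z := by rintro z rfl; rfl
  change (α ((extChartAt I x).symm (extChartAt I x z)) : E [⋀^Fin k]→L[ℝ] ℝ)
    (fun i ↦ (mfderivWithin 𝓘(ℝ, E) I (extChartAt I x).symm (range I) (extChartAt I x z))
      (mfderiv I 𝓘(ℝ, E) (extChartAt I x) z (v i))) = _
  rw [hα _ ((extChartAt I x).left_inv hz)]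
  congr 1
  funext i
  have := IsManifold.of_le (I := I) (M := N) (m := 1) (n := ∞) (by simp)
  exact congrArg (fun L : E →L[ℝ] E ↦ L (v i))
    (mfderivWithin_extChartAt_symm_comp_mfderiv_extChartAt' (I := I) (x := x) hz)

/-- The expression in charts of the pullback of a field of forms. -/
theorem FormField.inChart_pullback {k : ℕ} {g : N → N'} (α : FormField I' N' k) (p : N) (q : N')
    {y : E} (hy : y ∈ (extChartAt I p).target)
    (hg : MDifferentiableAt I I' g ((extChartAt I p).symm y))
    (hq : g ((extChartAt I p).symm y) ∈ (extChartAt I' q).source) (v : Fin k → E) :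
    FormField.inChart I (FormField.pullback I I' g α) p y v =
      FormField.inChart I' α q (extChartAt I' q (g ((extChartAt I p).symm y)))
        (fun i ↦ fderivWithin ℝ (extChartAt I' q ∘ g ∘ (extChartAt I p).symm) (range I) y (v i)) := by
  have := IsManifold.of_le (I := I) (M := N) (m := 1) (n := ∞) (by simp)
  have := IsManifold.of_le (I := I') (M := N') (m := 1) (n := ∞) (by simp)
  have hu : UniqueMDiffWithinAt 𝓘(ℝ, E) (range I) y :=
    (I.uniqueDiffOn y (extChartAt_target_subset_range p hy)).uniqueMDiffWithinAt
  have hs := mdifferentiableWithinAt_extChartAt_symm (I := I) hy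
  have hψ : MDifferentiableAt I' 𝓘(ℝ, E') (extChartAt I' q) (g ((extChartAt I p).symm y)) :=
    mdifferentiableAt_extChartAt (by rwa [extChartAt_source] at hq)
  have h1 : HasMFDerivWithinAt 𝓘(ℝ, E) 𝓘(ℝ, E') (extChartAt I' q ∘ g ∘ (extChartAt I p).symm)
      (range I) y _ :=
    hψ.hasMFDerivAt.comp_hasMFDerivWithinAt y
      (hg.hasMFDerivAt.comp_hasMFDerivWithinAt y hs.hasMFDerivWithinAt)
  rw [← mfderivWithin_eq_fderivWithin, h1.mfderivWithin hu]
  exact (FormField.inChart_apply_mfderiv α q hq _).symm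

end FormsInCharts

/-! ### Inward rays in boundary charts -/

section HalfSpace

variable {d : ℕ} {M : Type*} [TopologicalSpace M] [ChartedSpace (EuclideanHalfSpace (d + 1)) M]
  [IsManifold (𝓡∂ (d + 1)) ∞ M]

/-- The inward pointing unit vector of the half-space. -/
def inwardVec (d : ℕ) : EuclideanSpace ℝ (Fin (d + 1)) := EuclideanSpace.single 0 1

theorem eq_smul_inwardVec_add_consCLM (v : EuclideanSpace ℝ (Fin (d + 1))) :
    v = v 0 • inwardVec d + consCLM d (WithLp.toLp 2 fun i : Fin d ↦ v i.succ) := by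
  ext i
  refine Fin.cases ?_ (fun j ↦ ?_) i <;> simp [inwardVec, consCLM]

theorem extChartAt_bdry_zero (p : Bdry d M) : extChartAt (𝓡∂ (d + 1)) p.1 p.1 0 = 0 := by
  rw [extChartAt_val p (mem_extChartAt_source p)]
  exact consCLM_apply_zero _

omit [IsManifold (𝓡∂ (d + 1)) ∞ M] in
theorem tendsto_add_smul_inwardVec (p : Bdry d M) :
    Filter.Tendsto (fun t : ℝ ↦ extChartAt (𝓡∂ (d + 1)) p.1 p.1 + t • inwardVec d) (𝓝[>] 0)
      (𝓝 (extChartAt (𝓡∂ (d + 1)) p.1 p.1)) := by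
  have h := (hasDerivAt_add_smul (extChartAt (𝓡∂ (d + 1)) p.1 p.1) (inwardVec d) 0).continuousAt.tendsto
  simp only [zero_smul, add_zero] at h
  exact h.mono_left nhdsWithin_le_nhds

/-- A relative neighbourhood in the half-space contains `U ∩ {y | 0 < y 0}` for some open `U`, and
this set is open in the whole space and contains the ray for small `t > 0`. -/
theorem eventually_add_smul_inwardVec_mem_interior (p : Bdry d M)
    {T : Set (EuclideanSpace ℝ (Fin (d + 1)))}
    (hT : T ∈ 𝓝[range (𝓡∂ (d + 1))] (extChartAt (𝓡∂ (d + 1)) p.1 p.1)) :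
    ∀ᶠ t : ℝ in 𝓝[>] 0, extChartAt (𝓡∂ (d + 1)) p.1 p.1 + t • inwardVec d ∈ interior T ∧
      0 < (extChartAt (𝓡∂ (d + 1)) p.1 p.1 + t • inwardVec d) 0 := by
  obtain ⟨U, hU, hpU, hUT⟩ := mem_nhdsWithin.1 hT
  filter_upwards [(tendsto_add_smul_inwardVec p).eventually (hU.mem_nhds hpU),
    self_mem_nhdsWithin] with t ht ht0
  have ht0' : (0 : ℝ) < t := ht0
  have hpos : 0 < (extChartAt (𝓡∂ (d + 1)) p.1 p.1 + t • inwardVec d) 0 := by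
    rw [PiLp.add_apply, extChartAt_bdry_zero]
    simpa [inwardVec] using ht0'
  have hopen : IsOpen {y : EuclideanSpace ℝ (Fin (d + 1)) | 0 < y 0} :=
    isOpen_lt continuous_const (PiLp.continuous_apply 2 _ 0)
  refine ⟨mem_interior.2 ⟨U ∩ {y | 0 < y 0}, fun y hy ↦ hUT ⟨hy.1, ?_⟩,
    hU.inter hopen, ht, hpos⟩, hpos⟩
  rw [range_modelWithCornersEuclideanHalfSpace]
  exact le_of_lt (show (0 : ℝ) < y 0 from hy.2)

theorem extChartAt_symm_mem_interior {x : M} {y : EuclideanSpace ℝ (Fin (d + 1))}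
    (hy : y ∈ (extChartAt (𝓡∂ (d + 1)) x).target) (hy0 : 0 < y 0) :
    (extChartAt (𝓡∂ (d + 1)) x).symm y ∈ (𝓡∂ (d + 1)).interior M := by
  have hs := (extChartAt (𝓡∂ (d + 1)) x).map_target hy
  rw [extChartAt_source] at hs
  have h := mem_boundary_iff_chart d (chart_mem_atlas _ x) hs
  rw [← ModelWithCorners.compl_boundary]
  intro hb
  have h2 : extChartAt (𝓡∂ (d + 1)) x ((extChartAt (𝓡∂ (d + 1)) x).symm y) 0 = 0 := h.1 hb
  rw [(extChartAt (𝓡∂ (d + 1)) x).right_inv hy] at h2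
  exact hy0.ne' h2

theorem eventually_extChartAt_add_smul (p : Bdry d M) (u : EuclideanSpace ℝ (Fin d)) :
    ∀ᶠ s : ℝ in 𝓝 0, extChartAt (𝓡 d) p p + s • u ∈ (extChartAt (𝓡 d) p).target := by
  have h := (hasDerivAt_add_smul (extChartAt (𝓡 d) p p) u 0).continuousAt.tendsto
  simp only [zero_smul, add_zero] at h
  exact h.eventually (extChartAt_target_mem_nhds p)

theorem extChartAt_add_smul_consCLM (p : Bdry d M) (u : EuclideanSpace ℝ (Fin d)) (s : ℝ) :
    extChartAt (𝓡∂ (d + 1)) p.1 p.1 + s • consCLM d u =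
      consCLM d (extChartAt (𝓡 d) p p + s • u) := by
  rw [extChartAt_val p (mem_extChartAt_source p), map_add, map_smul]

end HalfSpace

/-! ### Smooth functions on the cut space near the boundary; the inclusion of `M_red` -/

namespace BoundaryCircleAction

variable {d : ℕ} {M : Type*} [TopologicalSpace M] [ChartedSpace (EuclideanHalfSpace (d + 1)) M]
  [IsManifold (𝓡∂ (d + 1)) ∞ M] {A : BoundaryCircleAction d M} {f : M → ℝ}

/-- On `∂M` the defining function vanishes, so `h ∘ c` is the smooth function `F(·, 0)`. -/
theorem smoothFunctions_apply_bdry (hf : A.IsInvariantBDF f) {h : A.CutSpace → ℝ}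
    (hh : h ∈ A.smoothFunctions f) :
    ContMDiff (𝓡 d) 𝓘(ℝ, ℝ) ∞ (h ∘ A.cutMap ∘ (Subtype.val : Bdry d M → M)) := by
  obtain ⟨-, V, ⟨hV, -, hbV, -⟩, F, hF, -, hFh⟩ := hh
  have h1 : ContMDiff (𝓡 d) ((𝓡∂ (d + 1)).prod 𝓘(ℝ, ℂ)) ∞
      (fun p : Bdry d M ↦ (p.1, (0 : ℂ))) := contMDiff_bdry_val.prodMk contMDiff_const
  have h2 := hF.comp_contMDiff h1 fun p ↦ ⟨hbV p.2, mem_univ _⟩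
  refine h2.congr fun p ↦ ?_
  have h3 := hFh p.1 (hbV p.2)
  rw [(hf.zero_iff p.1).2 p.2] at h3
  simpa using h3

section RedSpace

variable [ChartedSpace (EuclideanSpace ℝ (Fin (d - 1))) A.RedSpace]

theorem IsRedStructure.exists_section (hred : A.IsRedStructure) (y : A.RedSpace) :
    ∃ σ : A.RedSpace → Bdry d M, ContMDiffAt (𝓡 (d - 1)) (𝓡 d) ∞ σ y ∧
      ∀ᶠ w in 𝓝 y, A.redMap (σ w) = w := by
  obtain ⟨-, h⟩ := hred
  obtain ⟨W, hW, hy, Φ, τ, hΦ, -, hΦτ, -⟩ := h y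
  refine ⟨fun w ↦ Φ (w, 1), ?_, ?_⟩
  · have h1 : ContMDiff (𝓡 (d - 1)) ((𝓡 (d - 1)).prod (𝓡 1)) ∞
        (fun w : A.RedSpace ↦ (w, (1 : Circle))) := contMDiff_id.prodMk contMDiff_const
    have h2 : ContMDiffAt ((𝓡 (d - 1)).prod (𝓡 1)) (𝓡 d) ∞ Φ (y, 1) :=
      hΦ.contMDiffAt ((hW.prod isOpen_univ).mem_nhds ⟨hy, mem_univ _⟩)
    exact h2.comp y h1.contMDiffAt
  · filter_upwards [hW.mem_nhds hy] with w hw using (hΦτ w hw 1).1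

/-- Differentiating `π ∘ σ = id` for a local section `σ` gives `dπ` a right inverse at `σ y`. -/
theorem IsRedStructure.exists_mfderiv_surjective (hred : A.IsRedStructure) (y : A.RedSpace) :
    ∃ p, A.redMap p = y ∧ Surjective (mfderiv (𝓡 d) (𝓡 (d - 1)) A.redMap p) := by
  obtain ⟨σ, hσ, hσy⟩ := hred.exists_section y
  refine ⟨σ y, hσy.self_of_nhds, ?_⟩
  have h1 := (hred.1.mdifferentiable (by simp) (σ y)).hasMFDerivAt.comp y
    (hσ.mdifferentiableAt (by simp)).hasMFDerivAt
  have h2 := h1.congr_of_eventuallyEq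
    (show id =ᶠ[𝓝 y] A.redMap ∘ σ from hσy.mono fun w hw ↦ hw.symm)
  have h3 := h2.mfderiv
  rw [mfderiv_id] at h3
  intro v
  refine ⟨mfderiv (𝓡 (d - 1)) (𝓡 d) σ y v, ?_⟩
  exact (congrArg (fun L : EuclideanSpace ℝ (Fin (d - 1)) →L[ℝ] EuclideanSpace ℝ (Fin (d - 1)) ↦
    L v) h3).symm

theorem contMDiff_redInclusion [T2Space M] [SecondCountableTopology M] (hf : A.IsInvariantBDF f)
    [ChartedSpace (EuclideanSpace ℝ (Fin (d + 1))) A.CutSpace]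
    [IsManifold (𝓡 (d + 1)) ∞ A.CutSpace] (hcut : A.IsCutStructure f)
    (hred : A.IsRedStructure) :
    ContMDiff (𝓡 (d - 1)) (𝓡 (d + 1)) ∞ A.redInclusion := by
  have := A.t2Space_cutSpace
  intro y
  refine contMDiffAt_of_forall_comp A.continuous_redInclusion.continuousAt fun h hh ↦ ?_
  obtain ⟨σ, hσ, hσy⟩ := hred.exists_section y
  -- Near `y` the inclusion is `c ∘ i ∘ σ` for a local section `σ`.
  have h1 := (smoothFunctions_apply_bdry hf ((hcut h).1 hh)).contMDiffAt.comp y hσ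
  refine h1.congr_of_eventuallyEq ?_
  filter_upwards [hσy] with w hw
  simp only [comp_apply]
  rw [← A.redInclusion_redMap, hw]

end RedSpace

/-- Along the inward direction at a boundary point, the derivatives of `h ∘ c` in directions
tangent to the boundary converge to those of the restriction of `h ∘ c` to the boundary. -/
theorem tendsto_fderiv_comp_cutMap (hf : A.IsInvariantBDF f) {h : A.CutSpace → ℝ}
    (hh : h ∈ A.smoothFunctions f) (p : Bdry d M) (u : EuclideanSpace ℝ (Fin d)) :
    Filter.Tendsto (fun t : ℝ ↦ fderiv ℝ (h ∘ A.cutMap ∘ (extChartAt (𝓡∂ (d + 1)) p.1).symm)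
        (extChartAt (𝓡∂ (d + 1)) p.1 p.1 + t • inwardVec d) (consCLM d u)) (𝓝[>] 0)
      (𝓝 (mfderiv (𝓡 d) 𝓘(ℝ, ℝ) (h ∘ A.cutMap ∘ (Subtype.val : Bdry d M → M)) p u)) := by
  have hhb := (smoothFunctions_apply_bdry hf hh).mdifferentiable (by simp) p
  obtain ⟨-, V, ⟨hV, -, hbV, -⟩, F, hF, -, hFh⟩ := hh
  set φ := extChartAt (𝓡∂ (d + 1)) p.1
  set χ := extChartAt (𝓡 d) p
  -- The part of the chart at `p` on which the formula `h ∘ c = F(x, √f(x))` is available.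
  set T := φ.target ∩ φ.symm ⁻¹' V
  have hTr : T ∈ 𝓝[range (𝓡∂ (d + 1))] (φ p.1) :=
    Filter.inter_mem (extChartAt_target_mem_nhdsWithin p.1)
      (mem_nhdsWithin_of_mem_nhds (extChartAt_preimage_mem_nhds (hV.mem_nhds (hbV p.2))))
  have hTsub : T ⊆ range (𝓡∂ (d + 1)) :=
    inter_subset_left.trans (extChartAt_target_subset_range p.1)
  have hT : UniqueDiffOn ℝ T :=
    uniqueMDiffOn_iff_uniqueDiffOn.1 (hV.uniqueMDiffOn.uniqueMDiffOn_target_inter p.1)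
  have hy₀ : φ p.1 ∈ T := mem_of_mem_nhdsWithin
    (extChartAt_target_subset_range p.1 (mem_extChartAt_target p.1)) hTr
  have hφs : ContMDiffOn 𝓘(ℝ, EuclideanSpace ℝ (Fin (d + 1))) (𝓡∂ (d + 1)) ∞ φ.symm T :=
    (contMDiffOn_extChartAt_symm p.1).mono inter_subset_left
  have hG : ContDiffOn ℝ ∞ (f ∘ φ.symm) T := (hf.smooth.comp_contMDiffOn hφs).contDiffOn
  have hK : ContDiffOn ℝ ∞ (fun z : EuclideanSpace ℝ (Fin (d + 1)) × ℂ ↦ F (φ.symm z.1, z.2))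
      (T ×ˢ univ) := by
    have h1 : ContMDiffOn (𝓘(ℝ, EuclideanSpace ℝ (Fin (d + 1))).prod 𝓘(ℝ, ℂ))
        ((𝓡∂ (d + 1)).prod 𝓘(ℝ, ℂ)) ∞
        (fun z : EuclideanSpace ℝ (Fin (d + 1)) × ℂ ↦ (φ.symm z.1, z.2)) (T ×ˢ univ) :=
      (hφs.comp contMDiffOn_fst fun z hz ↦ hz.1).prodMk contMDiffOn_snd
    have h2 := hF.comp h1 fun z hz ↦ ⟨hz.1.2, mem_univ _⟩
    rw [← modelWithCornersSelf_prod, chartedSpaceSelf_prod] at h2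
    exact h2.contDiffOn
  have hv (u : EuclideanSpace ℝ (Fin d)) : ∀ᶠ s : ℝ in 𝓝 0, φ p.1 + s • consCLM d u ∈ T ∧
      (f ∘ φ.symm) (φ p.1 + s • consCLM d u) = 0 := by
    filter_upwards [eventually_extChartAt_add_smul p u] with s hs
    rw [extChartAt_add_smul_consCLM]
    have h1 := extChartAt_symm_consCLM p hs
    have h2 := extChartAt_val p (χ.map_target hs)
    have hsrc : (χ.symm (χ p + s • u)).1 ∈ φ.source := by
      have := χ.map_target hs
      rw [extChartAt_source] at this ⊢
      exact this
    rw [χ.right_inv hs] at h2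
    refine ⟨⟨?_, ?_⟩, ?_⟩
    · rw [← h2]; exact φ.map_source hsrc
    · rw [mem_preimage, ← h1]; exact hbV (χ.symm _).2
    · rw [comp_apply, ← h1]; exact (hf.zero_iff _).2 (χ.symm _).2
  have hGd := hG.differentiableOn (by simp) _ hy₀
  -- `df` kills the directions tangent to the boundary; if it also killed the inward one it would
  -- vanish at `p`.
  have hGe : fderivWithin ℝ (f ∘ φ.symm) T (φ p.1) (inwardVec d) ≠ 0 := by
    intro h0
    refine hf.deriv_ne_zero p.1 p.2 ?_
    have h1 : mfderiv (𝓡∂ (d + 1)) 𝓘(ℝ, ℝ) f p.1 =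
        fderivWithin ℝ (f ∘ φ.symm) (range (𝓡∂ (d + 1))) (φ p.1) :=
      if_pos (hf.smooth.mdifferentiable (by simp) p.1)
    have h2 : fderivWithin ℝ (f ∘ φ.symm) (range (𝓡∂ (d + 1))) (φ p.1) =
        fderivWithin ℝ (f ∘ φ.symm) T (φ p.1) :=
      fderivWithin_of_mem_nhdsWithin hTr ((𝓡∂ (d + 1)).uniqueDiffOn _ (hTsub hy₀)) hGd
    rw [h1, h2]
    refine ContinuousLinearMap.ext fun v ↦ ?_
    have h3 := fderivWithin_apply_eq_zero_of_eventually hGd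
      (hv (WithLp.toLp 2 fun i : Fin d ↦ v i.succ))
    change fderivWithin ℝ (f ∘ φ.symm) T (φ p.1) v = 0
    rw [eq_smul_inwardVec_add_consCLM v, map_add, map_smul, h0, h3, smul_zero, add_zero]
  have he := eventually_add_smul_inwardVec_mem_interior p hTr
  have hΦ : ∀ y ∈ T, (h ∘ A.cutMap ∘ φ.symm) y = F (φ.symm y, (√((f ∘ φ.symm) y) : ℝ)) :=
    fun y hy ↦ hFh _ hy.2
  have hlim := tendsto_fderiv_comp_sqrt hT hy₀ (hv u) (he.mono fun t ht ↦ ht.1) hG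
    (he.mono fun t ht ↦ by
      refine lt_of_le_of_ne (hf.nonneg _) fun h0 ↦ ?_
      have h1 := extChartAt_symm_mem_interior (interior_subset ht.1).1 ht.2
      rw [← ModelWithCorners.compl_boundary] at h1
      exact h1 ((hf.zero_iff _).1 h0.symm))
    hGe hK hΦ
  convert hlim using 2
  refine congrArg 𝓝 ?_
  -- The limit `DK(v, 0)` is also the derivative of `h ∘ c` along a line inside the boundary, hence
  -- equals the derivative of its restriction to `∂M`.
  have hd1 := hasDerivAt_comp_sqrt hy₀ (hv u) hK hΦ
  have hm : HasFDerivAt ((h ∘ A.cutMap ∘ (Subtype.val : Bdry d M → M)) ∘ χ.symm)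
      (mfderiv (𝓡 d) 𝓘(ℝ, ℝ) (h ∘ A.cutMap ∘ (Subtype.val : Bdry d M → M)) p :
        EuclideanSpace ℝ (Fin d) →L[ℝ] ℝ) (χ p + (0 : ℝ) • u) := by
    have h1 (L : EuclideanSpace ℝ (Fin d) →L[ℝ] ℝ) (hL : HasFDerivWithinAt
        ((h ∘ A.cutMap ∘ (Subtype.val : Bdry d M → M)) ∘ χ.symm) L (range (𝓡 d)) (χ p)) :
        HasFDerivAt ((h ∘ A.cutMap ∘ (Subtype.val : Bdry d M → M)) ∘ χ.symm) L
          (χ p + (0 : ℝ) • u) := by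
      rw [ModelWithCorners.range_eq_univ, hasFDerivWithinAt_univ] at hL
      simpa using hL
    exact h1 _ hhb.hasMFDerivAt.2
  have hd2 := hm.comp_hasDerivAt (0 : ℝ) (hasDerivAt_add_smul (χ p) u 0)
  refine hd2.unique (hd1.congr_of_eventuallyEq ?_)
  filter_upwards [eventually_extChartAt_add_smul p u] with s hs
  rw [extChartAt_add_smul_consCLM]
  simp only [comp_apply]
  rw [extChartAt_symm_consCLM p hs]

end BoundaryCircleAction

theorem ContinuousAlternatingMap.tendsto_apply {E : Type*} [NormedAddCommGroup E] [NormedSpace ℝ E]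
    {k : ℕ} {ι : Type*} {l : Filter ι} {η : ι → E [⋀^Fin k]→L[ℝ] ℝ} {v : ι → Fin k → E}
    {η₀ : E [⋀^Fin k]→L[ℝ] ℝ} {v₀ : Fin k → E} (hη : Filter.Tendsto η l (𝓝 η₀))
    (hv : ∀ i, Filter.Tendsto (fun t ↦ v t i) l (𝓝 (v₀ i))) :
    Filter.Tendsto (fun t ↦ η t (v t)) l (𝓝 (η₀ v₀)) := by
  have h1 := (ContinuousAlternatingMap.continuous_toContinuousMultilinearMap.tendsto η₀).comp hη
  have h2 : Continuous fun q : ContinuousMultilinearMap ℝ (fun _ : Fin k ↦ E) ℝ × (Fin k → E) ↦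
      q.1 q.2 := continuous_eval
  exact (h2.tendsto (η₀.toContinuousMultilinearMap, v₀)).comp
    (h1.prodMk_nhds (tendsto_pi_nhds.2 hv))

/-! ### Passing to the limit at the boundary: `c` and the forms -/

namespace BoundaryCircleAction

variable {d : ℕ} {M : Type*} [TopologicalSpace M] [ChartedSpace (EuclideanHalfSpace (d + 1)) M]
  [IsManifold (𝓡∂ (d + 1)) ∞ M] {A : BoundaryCircleAction d M} {f : M → ℝ}

/-- Points moving inward from a boundary point `p`, as seen in the chart at `p`. -/
theorem eventually_cutMap_chart (p : Bdry d M) {O : Set A.CutSpace} (hO : O ∈ 𝓝 (A.cutMap p.1)) :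
    ∀ᶠ t : ℝ in 𝓝[>] 0, ∀ y, y = extChartAt (𝓡∂ (d + 1)) p.1 p.1 + t • inwardVec d →
      y ∈ (extChartAt (𝓡∂ (d + 1)) p.1).target ∧
      (extChartAt (𝓡∂ (d + 1)) p.1).target ∈ 𝓝 y ∧
      (extChartAt (𝓡∂ (d + 1)) p.1).symm y ∈ (𝓡∂ (d + 1)).interior M ∧
      ∀ᶠ z in 𝓝 y, A.cutMap ((extChartAt (𝓡∂ (d + 1)) p.1).symm z) ∈ O := by
  have h1 : (extChartAt (𝓡∂ (d + 1)) p.1).target ∩ (extChartAt (𝓡∂ (d + 1)) p.1).symm ⁻¹'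
      (A.cutMap ⁻¹' O) ∈ 𝓝[range (𝓡∂ (d + 1))] (extChartAt (𝓡∂ (d + 1)) p.1 p.1) :=
    Filter.inter_mem (extChartAt_target_mem_nhdsWithin p.1)
      (mem_nhdsWithin_of_mem_nhds (extChartAt_preimage_mem_nhds
        (A.continuous_cutMap.continuousAt hO)))
  filter_upwards [eventually_add_smul_inwardVec_mem_interior p h1] with t ht y hy
  rw [← hy] at ht
  have h2 := mem_interior_iff_mem_nhds.1 ht.1
  have h3 := mem_of_mem_nhds h2
  exact ⟨h3.1, Filter.mem_of_superset h2 inter_subset_left,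
    extChartAt_symm_mem_interior h3.1 ht.2, Filter.mem_of_superset h2 inter_subset_right⟩

variable [T2Space M] [SecondCountableTopology M]
  [ChartedSpace (EuclideanSpace ℝ (Fin (d + 1))) A.CutSpace]
  [IsManifold (𝓡 (d + 1)) ∞ A.CutSpace]

theorem contMDiff_cutMap_val (hf : A.IsInvariantBDF f) (hcut : A.IsCutStructure f) :
    ContMDiff (𝓡 d) (𝓡 (d + 1)) ∞ (A.cutMap ∘ (Subtype.val : Bdry d M → M)) := by
  have := A.t2Space_cutSpace
  intro p
  exact contMDiffAt_of_forall_comp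
    (A.continuous_cutMap.comp continuous_subtype_val).continuousAt
    fun h hh ↦ (smoothFunctions_apply_bdry hf ((hcut h).1 hh)).contMDiffAt

/-- Along the inward direction at a boundary point, the derivatives of `c` in directions tangent to
the boundary converge, in charts, to those of the restriction of `c` to the boundary. -/
theorem tendsto_fderivWithin_cutMap (hf : A.IsInvariantBDF f) (hcut : A.IsCutStructure f)
    (p : Bdry d M) (u : EuclideanSpace ℝ (Fin d)) :
    Filter.Tendsto (fun t : ℝ ↦ fderivWithin ℝ (extChartAt (𝓡 (d + 1)) (A.cutMap p.1) ∘ A.cutMap ∘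
        (extChartAt (𝓡∂ (d + 1)) p.1).symm) (range (𝓡∂ (d + 1)))
        (extChartAt (𝓡∂ (d + 1)) p.1 p.1 + t • inwardVec d) (consCLM d u)) (𝓝[>] 0)
      (𝓝 (mfderiv (𝓡 d) (𝓡 (d + 1)) (A.cutMap ∘ (Subtype.val : Bdry d M → M)) p u :
        EuclideanSpace ℝ (Fin (d + 1)))) := by
  have := A.t2Space_cutSpace
  have hI1 := IsManifold.of_le (I := 𝓡 (d + 1)) (M := A.CutSpace) (m := 1) (n := ∞) (by simp)
  set ψ := extChartAt (𝓡 (d + 1)) (A.cutMap p.1)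
  set φ := extChartAt (𝓡∂ (d + 1)) p.1
  set Ψ := ψ ∘ A.cutMap ∘ φ.symm
  -- Convergence is checked coordinatewise. Each coordinate of the chart is replaced near `c(p)` by
  -- a global smooth `h`, since the structure on `M_cut` is specified by global functions only.
  refine ((PiLp.continuous_toLp 2 _).tendsto _).comp (tendsto_pi_nhds.2 fun i ↦ ?_)
  obtain ⟨h, hh, hhψ⟩ := exists_contMDiff_eventuallyEq_coord (A.cutMap p.1) i
  have hlim := tendsto_fderiv_comp_cutMap hf ((hcut h).1 hh) p u
  let π : EuclideanSpace ℝ (Fin (d + 1)) →L[ℝ] ℝ := EuclideanSpace.proj i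
  have hval : (mfderiv (𝓡 d) 𝓘(ℝ, ℝ) (h ∘ A.cutMap ∘ (Subtype.val : Bdry d M → M)) p u : ℝ) =
      π (mfderiv (𝓡 d) (𝓡 (d + 1)) (A.cutMap ∘ (Subtype.val : Bdry d M → M)) p u) := by
    have h1 : HasMFDerivAt (𝓡 (d + 1)) 𝓘(ℝ, EuclideanSpace ℝ (Fin (d + 1))) ψ (A.cutMap p.1) _ :=
      (mdifferentiableAt_extChartAt (mem_chart_source _ _)).hasMFDerivAt
    -- A preferred chart has identity derivative at its own base point, so `dh` at `c(p)` is just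
    -- the `i`-th coordinate.
    rw [mfderiv_extChartAt_self] at h1
    have h2 := (π.hasMFDerivAt (x := ψ (A.cutMap p.1))).comp (A.cutMap p.1) h1
    have h3 : HasMFDerivAt (𝓡 (d + 1)) 𝓘(ℝ, ℝ) h (A.cutMap p.1) _ :=
      h2.congr_of_eventuallyEq hhψ
    have h4 := ((contMDiff_cutMap_val hf hcut).mdifferentiable (by simp) p).hasMFDerivAt
    have h5 := HasMFDerivAt.comp p h3 h4
    exact congrArg (fun L : EuclideanSpace ℝ (Fin d) →L[ℝ] ℝ ↦ L u) h5.mfderiv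
  rw [hval] at hlim
  refine hlim.congr' ?_
  filter_upwards [eventually_cutMap_chart p (Filter.inter_mem hhψ
    (extChartAt_source_mem_nhds (I := 𝓡 (d + 1)) (A.cutMap p.1)))] with t ht
  obtain ⟨hyT, hTy, hyi, hyO⟩ := ht _ rfl
  set y := φ p.1 + t • inwardVec d
  have hry : range (𝓡∂ (d + 1)) ∈ 𝓝 y :=
    Filter.mem_of_superset hTy (extChartAt_target_subset_range p.1)
  rw [fderivWithin_of_mem_nhds hry]
  have hΨ : DifferentiableAt ℝ Ψ y := by
    rw [← mdifferentiableAt_iff_differentiableAt]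
    have h1 : MDifferentiableAt (𝓡 (d + 1)) 𝓘(ℝ, EuclideanSpace ℝ (Fin (d + 1))) ψ
        (A.cutMap (φ.symm y)) := mdifferentiableAt_extChartAt (by
      have := hyO.self_of_nhds.2
      rwa [extChartAt_source] at this)
    have h2 := (contMDiffAt_cutMap (A := A) hcut hyi).mdifferentiableAt (by simp)
    have h3 := (mdifferentiableWithinAt_extChartAt_symm (I := 𝓡∂ (d + 1)) hyT).mdifferentiableAt hry
    exact h1.comp y (h2.comp y h3)
  have h1 : h ∘ A.cutMap ∘ φ.symm =ᶠ[𝓝 y] π ∘ Ψ := by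
    filter_upwards [hyO] with z hz using hz.1
  rw [h1.fderiv_eq, fderiv_comp y π.differentiableAt hΨ, π.fderiv]
  rfl

/-- Along the inward ray the chart expressions of `β` and of `c^* β_cut` on vectors tangent to the
boundary agree. The first tends to `i^* β` and the second to `(c ∘ i)^* β_cut`, so uniqueness of
limits gives the equality at `p`. -/
theorem pullback_cutMap_val (hf : A.IsInvariantBDF f) (hcut : A.IsCutStructure f)
    {k : ℕ} {β : DiffForm (𝓡∂ (d + 1)) M k} {βcut : DiffForm (𝓡 (d + 1)) A.CutSpace k}
    (hβcut : A.IsCutForm β βcut) :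
    FormField.pullback (𝓡 d) (𝓡 (d + 1)) (A.cutMap ∘ (Subtype.val : Bdry d M → M))
      βcut.toField = toBdry β := by
  funext p
  refine ContinuousAlternatingMap.ext fun u ↦ ?_
  set φ := extChartAt (𝓡∂ (d + 1)) p.1
  set ψ := extChartAt (𝓡 (d + 1)) (A.cutMap p.1)
  have hyt := tendsto_add_smul_inwardVec p
  have hev := eventually_cutMap_chart p
    (extChartAt_source_mem_nhds (I := 𝓡 (d + 1)) (A.cutMap p.1))
  have hlim1 : Filter.Tendsto (fun t : ℝ ↦ FormField.inChart (𝓡∂ (d + 1)) β.toField p.1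
      (φ p.1 + t • inwardVec d) (fun i ↦ consCLM d (u i))) (𝓝[>] 0)
      (𝓝 (toBdry β p u)) := by
    have h1 : toBdry β p u = FormField.inChart (𝓡∂ (d + 1)) β.toField p.1 (φ p.1)
        (fun i ↦ consCLM d (u i)) := by
      rw [FormField.inChart_self]
      change β.toField p.1 (fun i ↦ mfderiv (𝓡 d) (𝓡∂ (d + 1)) Subtype.val p (u i)) = _
      rw [mfderiv_bdry_val]
      rfl
    rw [h1]
    refine ContinuousAlternatingMap.tendsto_apply ?_ fun i ↦ tendsto_const_nhds
    exact ((β.smooth p.1).continuousOn _ (mem_extChartAt_target p.1)).tendsto.comp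
      (tendsto_nhdsWithin_iff.2 ⟨hyt, hev.mono fun t ht ↦ (ht _ rfl).1⟩)
  have hlim2 : Filter.Tendsto (fun t : ℝ ↦ FormField.inChart (𝓡 (d + 1)) βcut.toField (A.cutMap p.1)
      (ψ (A.cutMap (φ.symm (φ p.1 + t • inwardVec d))))
      (fun i ↦ fderivWithin ℝ (ψ ∘ A.cutMap ∘ φ.symm) (range (𝓡∂ (d + 1)))
        (φ p.1 + t • inwardVec d) (consCLM d (u i)))) (𝓝[>] 0)
      (𝓝 (FormField.inChart (𝓡 (d + 1)) βcut.toField (A.cutMap p.1) (ψ (A.cutMap p.1))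
        (fun i ↦ mfderiv (𝓡 d) (𝓡 (d + 1)) (A.cutMap ∘ (Subtype.val : Bdry d M → M)) p (u i)))) := by
    refine ContinuousAlternatingMap.tendsto_apply ?_
      fun i ↦ tendsto_fderivWithin_cutMap hf hcut p (u i)
    have h1 : ContinuousAt (FormField.inChart (𝓡 (d + 1)) βcut.toField (A.cutMap p.1))
        (ψ (A.cutMap p.1)) :=
      -- `M_cut` has no boundary, so the chart target is a full neighbourhood of the image of
      -- `c(p)`.
      (βcut.smooth (A.cutMap p.1)).continuousOn.continuousAt (extChartAt_target_mem_nhds _)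
    have h2 : ContinuousAt (ψ ∘ A.cutMap ∘ φ.symm) (φ p.1) := by
      have h3 : ContinuousAt ψ (A.cutMap (φ.symm (φ p.1))) := by
        rw [extChartAt_to_inv]; exact continuousAt_extChartAt _
      exact ContinuousAt.comp (f := A.cutMap ∘ φ.symm) h3
        (A.continuous_cutMap.continuousAt.comp' (continuousAt_extChartAt_symm p.1))
    have h4 := h2.tendsto.comp hyt
    simp only [comp_apply] at h4
    rw [extChartAt_to_inv] at h4
    exact h1.tendsto.comp h4
  refine (FormField.inChart_self βcut.toField (A.cutMap p.1) _).symm.trans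
    (tendsto_nhds_unique hlim2 (hlim1.congr' ?_))
  filter_upwards [hev] with t ht
  obtain ⟨hyT, -, hyi, hyO⟩ := ht _ rfl
  set y := φ p.1 + t • inwardVec d
  rw [← FormField.inChart_pullback βcut.toField p.1 (A.cutMap p.1) hyT
    ((contMDiffAt_cutMap (A := A) hcut hyi).mdifferentiableAt (by simp)) hyO.self_of_nhds]
  have h1 := hβcut _ hyi
  simp only [FormField.inChart]
  rw [h1]

end BoundaryCircleAction

/-! ### Descent to the reduced space -/

theorem mainTheorem6 (d : ℕ) (M : Type*) [TopologicalSpace M] [T2Space M]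
    [SecondCountableTopology M] [ChartedSpace (EuclideanHalfSpace (d + 1)) M]
    [IsManifold (𝓡∂ (d + 1)) ∞ M] (A : BoundaryCircleAction d M)
    (f : M → ℝ) (hf : A.IsInvariantBDF f)
    [ChartedSpace (EuclideanSpace ℝ (Fin (d + 1))) A.CutSpace]
    [IsManifold (𝓡 (d + 1)) ∞ A.CutSpace] (hcut : A.IsCutStructure f)
    [ChartedSpace (EuclideanSpace ℝ (Fin (d - 1))) A.RedSpace]
    [IsManifold (𝓡 (d - 1)) ∞ A.RedSpace] (hred : A.IsRedStructure)
    (k : ℕ) (β : DiffForm (𝓡∂ (d + 1)) M k)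
    (hbasic : A.IsBasicOnBdry β) (hinv : A.IsInvariantNearBdry β)
    (βcut : DiffForm (𝓡 (d + 1)) A.CutSpace k) (hβcut : A.IsCutForm β βcut)
    (βred : DiffForm (𝓡 (d - 1)) A.RedSpace k) (hβred : A.IsRedForm β βred) :
    ContMDiff (𝓡 (d - 1)) (𝓡 (d + 1)) ∞ A.redInclusion ∧
      βred.toField =
        FormField.pullback (𝓡 (d - 1)) (𝓡 (d + 1)) A.redInclusion βcut.toField := by
  have hsm := BoundaryCircleAction.contMDiff_redInclusion hf hcut hred
  refine ⟨hsm, funext fun y ↦ ?_⟩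
  obtain ⟨p, rfl, hp⟩ := hred.exists_mfderiv_surjective y
  refine ContinuousAlternatingMap.ext fun v ↦ ?_
  -- Vectors at `y` are lifted through the surjective `dπ`, so it suffices to compare the pullbacks
  -- to `∂M`, using `j ∘ π = c ∘ i`.
  choose u hu using fun i ↦ hp (v i)
  obtain rfl : (fun i ↦ mfderiv (𝓡 d) (𝓡 (d - 1)) A.redMap p (u i)) = v := funext hu
  have h1 : FormField.pullback (𝓡 d) (𝓡 (d - 1)) A.redMap βred.toField p u = _ :=
    congrFun (congrArg DFunLike.coe (congrFun (hβred.trans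
      (BoundaryCircleAction.pullback_cutMap_val hf hcut hβcut).symm) p)) u
  have h2 : mfderiv (𝓡 d) (𝓡 (d + 1)) (A.redInclusion ∘ A.redMap) p = _ :=
    mfderiv_comp p (hsm.mdifferentiable (by simp) (A.redMap p))
      (hred.1.mdifferentiable (by simp) p)
  refine h1.trans ?_
  change βcut.toField (A.redInclusion (A.redMap p))
    (fun i ↦ mfderiv (𝓡 d) (𝓡 (d + 1)) (A.redInclusion ∘ A.redMap) p (u i)) = _
  rw [h2]
  rfl

end
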